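/- Let $A$ be a separable $C^*$-algebra and $B$ a $C^*$-algebra (for instance a stable one). Let $\mathbb R_+=[0,\infty)$, let $C_b(\mathbb R_+;B)$ be the $C^*$-algebra of bounded norm-continuous $B$-valued functions on $\mathbb R_+$, $C_0(\mathbb R_+;B)$ its ideal of functions tending to $0$ at infinity, and $IB=C([0,1];B)$. For $x,y\in C_b(\mathbb R_+;B)$ write $x\sim y$ if $x-y\in C_0(\mathbb R_+;B)$. **Compact asymptotic $KK$-cycles.** Let $\Phi^\pm:A\to C_b(\mathbb R_+;B)$ be continuous maps, let $E$ be the $C^*$-algebra generated by $\Phi^+(A)\cup\Phi^-(A)$ and $D$ the closed two-sided ideal of $E$ generated by all $\Phi^+(a)-\Phi^-(a)$, $a\in A$. The pair $(\Phi^+,\Phi^-)$ is a *compact asymptotic $KK$-cycle* from $A$ to $B$ if $\Phi^\pm(\lambda a)=\lambda\Phi^\pm(a)$, $\Phi^\pm(a^*)\sim\Phi^\pm(a)^*$, $(\Phi^\pm(a+b)-\Phi^\pm(a)-\Phi^\pm(b))x\sim 0$ and $(\Phi^\pm(ab)-\Phi^\pm(a)\Phi^\pm(b))x\sim 0$ for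 all $\lambda\in\mathbb C$, $a,b\in A$, $x\in D$. Two of them are homotopic if they are the evaluations at $0$ and $1$ of a compact asymptotic $KK$-cycle from $A$ to $IB$. $EM(A,B)$ is the set of homotopy classes. **The direct limit $EN(A,B)$.** An asymptotic homomorphism from $C$ to $B$ is here a continuous map $\psi:C\to C_b(\mathbb R_+;B)$ with $\psi(\lambda c)=\lambda\psi(c)$, $\psi(c^*)\sim\psi(c)^*$, $\psi(c+d)\sim\psi(c)+\psi(d)$, $\psi(cd)\sim\psi(c)\psi(d)$ for all $\lambda\in\mathbb C$, $c,d\in C$. Let $\mathcal E_A$ be the class of pairs $(C,p)$ with $C$ a separable $C^*$-algebra and $p:C\to A$ a surjective $*$-homomorphism, directed by: $(C,p)\le(C',p')$ if there is a surjective $*$-homomorphism $\kappa:C'\to C$ with $p'=p\circ\kappa$. For $(C,p)\in\mathcal E_A$ and $J=\ker p$ let $EN(C,J;B)$ be the set of homotopy classes of pairs $(\psi^+,\psi^-)$ of asymptotic homomorphisms from $C$ to $B$ with $\psi^+|_J=\psi^-|_J$, homotopies being pairs of asymptotic homomorphisms from $C$ to $IB$ that agree on $J$. Let $EN(A,B)=\varinjlim_{C\in\mathcal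 E_A}EN(C,J;B)$ along the maps $\kappa^*[(\psi^+,\psi^-)]=[(\psi^+\circ\kappa,\psi^-\circ\kappa)]$. **Addition.** If $s_1,s_2$ are isometries in the multiplier algebra of $B$ with $s_1s_1^*+s_2s_2^*=1$ (they exist when $B$ is stable), put $[(\Phi^+,\Phi^-)]+[(\Psi^+,\Psi^-)]=[(s_1\Phi^+s_1^*+s_2\Psi^+s_2^*,\;s_1\Phi^-s_1^*+s_2\Psi^-s_2^*)]$ on $EM(A,B)$; the same formula defines an addition on each $EN(C,J;B)$ and hence on $EN(A,B)$. **Theorem.** Every $(C,p)\in\mathcal E_A$ admits a continuous section $s:A\to C$ of $p$ with $s(\lambda a)=\lambda s(a)$ and $s(a^*)=s(a)^*$. For every such $C$ and $s$ and every pair $(\psi^+,\psi^-)$ of asymptotic homomorphisms from $C$ to $B$ that agree on $J$, the pair $(\psi^+\circ s,\psi^-\circ s)$ is a compact asymptotic $KK$-cycle, and there is exactly one map $\gamma:EN(A,B)\to EM(A,B)$ with $$\gamma[(\psi^+,\psi^-)]=[(\psi^+\circ s,\psi^-\circ s)]$$ for all $C$, $(\psi^+,\psi^-)$ and $s$. The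 map $\gamma$ is an isomorphism: it is bijective, and it is additive for the additions defined by any such $s_1,s_2$. -/

import Mathlib

universe u v w

namespace AsympKK

open Filter
open scoped Topology NNReal BoundedContinuousFunction MultiplierAlgebra CStarAlgebra

/-! ### The function algebras -/

/-- `C_b(ℝ₊; B)`, bounded norm-continuous functions on `ℝ₊ = [0, ∞)` with values in `B`. -/
abbrev Cb (B : Type v) [NonUnitalCStarAlgebra B] : Type v := ℝ≥0 →ᵇ B

/-- `IB = C([0, 1]; B)`. -/
abbrev IB (B : Type v) [NonUnitalCStarAlgebra B] : Type v := C(unitInterval, B)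

/-- Membership in the ideal `C_0(ℝ₊; B)` of `C_b(ℝ₊; B)`: the function tends to zero at infinity. -/
def Vanishes {B : Type v} [NonUnitalCStarAlgebra B] (f : Cb B) : Prop :=
  Tendsto (fun t => f t) atTop (𝓝 0)

section Cycles

variable {A : Type u} {B : Type v} [NonUnitalCStarAlgebra B]

/-- The `C*`-algebra `E` generated in `C_b(ℝ₊; B)` by all `Φ⁺(a)` and `Φ⁻(a)`. -/
noncomputable def algE (Φp Φm : A → Cb B) : NonUnitalStarSubalgebra ℂ (Cb B) :=
  (NonUnitalStarAlgebra.adjoin ℂ (Set.range Φp ∪ Set.range Φm)).topologicalClosure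

/-- The closed two-sided ideal `D` of `E` generated by all `Φ⁺(a) - Φ⁻(a)`: the smallest closed
subspace that contains these elements and is stable under multiplication by `E` on both sides. -/
noncomputable def idealD (Φp Φm : A → Cb B) : Submodule ℂ (Cb B) :=
  sInf {S | IsClosed (S : Set (Cb B)) ∧ (∀ a, Φp a - Φm a ∈ S) ∧
    ∀ e ∈ algE Φp Φm, ∀ x ∈ S, e * x ∈ S ∧ x * e ∈ S}

variable [NonUnitalCStarAlgebra A]

/-- `(Φ⁺, Φ⁻)` is a compact asymptotic `KK`-cycle from `A` to `B`: both maps are continuous,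
homogeneous and asymptotically involutive, and their defects from additivity and multiplicativity
annihilate `D` modulo `C_0(ℝ₊; B)`. -/
structure IsCompactCycle (Φp Φm : A → Cb B) : Prop where
  continuous_pos : Continuous Φp
  continuous_neg : Continuous Φm
  smul_pos : ∀ (z : ℂ) (a : A), Φp (z • a) = z • Φp a
  smul_neg : ∀ (z : ℂ) (a : A), Φm (z • a) = z • Φm a
  star_pos : ∀ a : A, Vanishes (Φp (star a) - star (Φp a))
  star_neg : ∀ a : A, Vanishes (Φm (star a) - star (Φm a))
  add_pos : ∀ (a b : A), ∀ x ∈ idealD Φp Φm, Vanishes ((Φp (a + b) - Φp a - Φp b) * x)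
  add_neg : ∀ (a b : A), ∀ x ∈ idealD Φp Φm, Vanishes ((Φm (a + b) - Φm a - Φm b) * x)
  mul_pos : ∀ (a b : A), ∀ x ∈ idealD Φp Φm, Vanishes ((Φp (a * b) - Φp a * Φp b) * x)
  mul_neg : ∀ (a b : A), ∀ x ∈ idealD Φp Φm, Vanishes ((Φm (a * b) - Φm a * Φm b) * x)

variable (A B) in
/-- Compact asymptotic `KK`-cycles from `A` to `B`. -/
structure CompactCycle : Type (max u v) where
  pos : A → Cb B
  neg : A → Cb B
  isCycle : IsCompactCycle pos neg

/-- Two compact asymptotic `KK`-cycles from `A` to `B` are homotopic if they are the evaluations at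
`0` and `1` of one from `A` to `IB`. -/
def CompactCycle.Homotopic (Φ₀ Φ₁ : CompactCycle A B) : Prop :=
  ∃ Ψ : CompactCycle A (IB B), ∀ (a : A) (t : ℝ≥0),
    Ψ.pos a t 0 = Φ₀.pos a t ∧ Ψ.neg a t 0 = Φ₀.neg a t ∧
    Ψ.pos a t 1 = Φ₁.pos a t ∧ Ψ.neg a t 1 = Φ₁.neg a t

variable (A B) in
/-- `EM(A, B)`: the quotient of the compact asymptotic `KK`-cycles by homotopy. -/
def EM : Type (max u v) := Quot (CompactCycle.Homotopic (A := A) (B := B))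

/-- The homotopy class of a compact asymptotic `KK`-cycle. -/
def EM.mk (Φ : CompactCycle A B) : EM A B := Quot.mk _ Φ

/-- `φ` is an asymptotic homomorphism from `A` to `B`: a continuous, homogeneous map
`A → C_b(ℝ₊; B)` that is a `*`-homomorphism modulo `C_0(ℝ₊; B)`. -/
structure IsAsympHom (φ : A → Cb B) : Prop where
  continuous : Continuous φ
  map_smul : ∀ (z : ℂ) (a : A), φ (z • a) = z • φ a
  map_star : ∀ a : A, Vanishes (φ (star a) - star (φ a))
  map_add : ∀ a b : A, Vanishes (φ (a + b) - φ a - φ b)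
  map_mul : ∀ a b : A, Vanishes (φ (a * b) - φ a * φ b)

end Cycles

/-! ### Separable extensions of `A` and the direct limit -/

/-- An object of `𝓔_A`: a separable `C*`-algebra `C` with a surjective `*`-homomorphism
`p : C → A`. -/
structure SepExt (A : Type u) [NonUnitalCStarAlgebra A] : Type (max u (w + 1)) where
  C : Type w
  [cstar : NonUnitalCStarAlgebra C]
  [separable : TopologicalSpace.SeparableSpace C]
  p : C →⋆ₙₐ[ℂ] A
  surjective : Function.Surjective p

attribute [instance] SepExt.cstar SepExt.separable

/-- A surjective `*`-homomorphism `C' → C` over `A`; it exists if and only if `C ≤ C'`. -/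
structure SepExt.Hom {A : Type u} [NonUnitalCStarAlgebra A] (X' X : SepExt.{u, w} A) : Type w where
  toHom : X'.C →⋆ₙₐ[ℂ] X.C
  surjective : Function.Surjective toHom
  comm : ∀ c, X.p (toHom c) = X'.p c

section Pairs

variable {A : Type u} [NonUnitalCStarAlgebra A]

/-- Pairs of asymptotic homomorphisms from `C` to `B` that agree on `J = ker p`. -/
structure Pair (X : SepExt.{u, w} A) (B : Type v) [NonUnitalCStarAlgebra B] : Type (max w v) where
  pos : X.C → Cb B
  neg : X.C → Cb B
  isAsympHom_pos : IsAsympHom pos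
  isAsympHom_neg : IsAsympHom neg
  agree : ∀ c, X.p c = 0 → pos c = neg c

variable {B : Type v} [NonUnitalCStarAlgebra B] {X X' Y : SepExt.{u, w} A}

/-- Homotopy of pairs, through pairs from `C` to `IB` that agree on `J`. -/
def Pair.Homotopic (ψ₀ ψ₁ : Pair X B) : Prop :=
  ∃ φ : Pair X (IB B), ∀ (c : X.C) (t : ℝ≥0),
    φ.pos c t 0 = ψ₀.pos c t ∧ φ.neg c t 0 = ψ₀.neg c t ∧
    φ.pos c t 1 = ψ₁.pos c t ∧ φ.neg c t 1 = ψ₁.neg c t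

/-- `EN(C, J; B)`: homotopy classes of pairs of asymptotic homomorphisms that agree on `J`. -/
def ENJ (X : SepExt.{u, w} A) (B : Type v) [NonUnitalCStarAlgebra B] : Type (max w v) :=
  Quot (Pair.Homotopic (X := X) (B := B))

/-- The homotopy class of a pair. -/
def ENJ.mk (ψ : Pair X B) : ENJ X B := Quot.mk _ ψ

/-- Composition of a pair on `C` with a surjection `κ : C' → C` over `A`. -/
def Pair.pullback (κ : SepExt.Hom X' X) (ψ : Pair X B) : Pair X' B where
  pos c := ψ.pos (κ.toHom c)
  neg c := ψ.neg (κ.toHom c)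
  isAsympHom_pos :=
    { continuous := ψ.isAsympHom_pos.continuous.comp (map_continuous κ.toHom)
      map_smul := fun z a => by rw [map_smul, ψ.isAsympHom_pos.map_smul]
      map_star := fun a => by rw [map_star]; exact ψ.isAsympHom_pos.map_star _
      map_add := fun a b => by rw [map_add]; exact ψ.isAsympHom_pos.map_add _ _
      map_mul := fun a b => by rw [map_mul]; exact ψ.isAsympHom_pos.map_mul _ _ }
  isAsympHom_neg :=
    { continuous := ψ.isAsympHom_neg.continuous.comp (map_continuous κ.toHom)
      map_smul := fun z a => by rw [map_smul, ψ.isAsympHom_neg.map_smul]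
      map_star := fun a => by rw [map_star]; exact ψ.isAsympHom_neg.map_star _
      map_add := fun a b => by rw [map_add]; exact ψ.isAsympHom_neg.map_add _ _
      map_mul := fun a b => by rw [map_mul]; exact ψ.isAsympHom_neg.map_mul _ _ }
  agree c hc := ψ.agree _ (by rw [κ.comm, hc])

/-- The map `κ^* : EN(C, J; B) → EN(C', J'; B)`. -/
def ENJ.pullback (κ : SepExt.Hom X' X) : ENJ X B → ENJ X' B :=
  Quot.map (Pair.pullback κ) fun _ _ ⟨φ, h⟩ => ⟨φ.pullback κ, fun c t => h (κ.toHom c) t⟩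

variable (A B) in
/-- One step in the direct system: an element of `EN(C, J; B)` and its image in
`EN(C', J'; B)`. -/
def ENStep (x x' : Σ X : SepExt.{u, max u v} A, ENJ X B) : Prop :=
  ∃ κ : SepExt.Hom x'.1 x.1, x'.2 = ENJ.pullback κ x.2

variable (A B) in
/-- `EN(A, B)`, the direct limit of `EN(C, J; B)` over `𝓔_A`. -/
def EN : Type (max (u + 1) (v + 1)) := Quot (ENStep A B)

/-- The element of `EN(A, B)` represented by a pair of asymptotic homomorphisms from `C`. -/
def EN.mk (X : SepExt.{u, max u v} A) (ψ : Pair X B) : EN A B := Quot.mk _ ⟨X, ENJ.mk ψ⟩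

/-- `s` is a continuous homogeneous `*`-respecting section of `p : C → A`. -/
structure SepExt.IsSection (X : SepExt.{u, w} A) (s : A → X.C) : Prop where
  continuous : Continuous s
  map_smul : ∀ (z : ℂ) (a : A), s (z • a) = z • s a
  map_star : ∀ a : A, s (star a) = star (s a)
  right_inv : ∀ a : A, X.p (s a) = a

/-- `γ` is the map `EN(A, B) → EM(A, B)` given by composition with sections:
`γ[(ψ⁺, ψ⁻)] = [(ψ⁺ ∘ s, ψ⁻ ∘ s)]` for all `C`, all pairs on `C` and all sections `s : A → C`. -/
def IsGamma (γ : EN A B → EM A B) : Prop :=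
  ∀ (X : SepExt.{u, max u v} A) (ψ : Pair X B) (s : A → X.C), X.IsSection s →
    ∃ h : IsCompactCycle (fun a => ψ.pos (s a)) (fun a => ψ.neg (s a)),
      γ (EN.mk X ψ) = EM.mk ⟨_, _, h⟩

end Pairs

/-! ### Addition -/

/-- Isometries `s₁, s₂` in the multiplier algebra of `B` with `s₁ s₁* + s₂ s₂* = 1`. -/
structure IsometryPair (B : Type v) [NonUnitalCStarAlgebra B] : Type v where
  s₁ : 𝓜(ℂ, B)
  s₂ : 𝓜(ℂ, B)
  isometry₁ : star s₁ * s₁ = 1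
  isometry₂ : star s₂ * s₂ = 1
  sum_eq_one : s₁ * star s₁ + s₂ * star s₂ = 1

section Maps

variable {B B₁ B₂ : Type v} [NonUnitalCStarAlgebra B] [NonUnitalCStarAlgebra B₁]
  [NonUnitalCStarAlgebra B₂]

/-- The map `b ↦ m b m*` on `B`, for a multiplier `m`. -/
noncomputable def conjBy (m : 𝓜(ℂ, B)) : B →L[ℂ] B := m.fst.comp (star m).snd

theorem fst_mul (m : 𝓜(ℂ, B)) (x y : B) : m.fst (x * y) = m.fst x * y := by
  have h : ∀ z : B, z * m.fst (x * y) = z * (m.fst x * y) := fun z => by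
    rw [← m.central, ← mul_assoc, m.central, mul_assoc]
  have h2 : star (m.fst (x * y) - m.fst x * y) * (m.fst (x * y) - m.fst x * y) = 0 := by
    rw [mul_sub, h, sub_self]
  exact sub_eq_zero.1 ((CStarRing.star_mul_self_eq_zero_iff _).1 h2)

theorem coe_conjBy (m : 𝓜(ℂ, B)) (b : B) :
    DoubleCentralizer.coe ℂ (conjBy m b) = m * DoubleCentralizer.coe ℂ b * star m := by
  refine DoubleCentralizer.ext _ _ _ _ (Prod.ext ?_ ?_) <;> ext x
  · have h : star (m.fst (star b)) * x = b * star (m.snd (star x)) := by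
      apply star_injective
      simpa using (m.central (star x) (star b)).symm
    simp [conjBy, ← fst_mul, h]
  · simp [conjBy, ← m.central, fst_mul]

/-- Two `*`-homomorphisms with orthogonal ranges. -/
structure OrthMaps (T₁ : B₁ →L[ℂ] B) (T₂ : B₂ →L[ℂ] B) : Prop where
  mul₁ : ∀ x y, T₁ (x * y) = T₁ x * T₁ y
  mul₂ : ∀ x y, T₂ (x * y) = T₂ x * T₂ y
  star₁ : ∀ x, T₁ (star x) = star (T₁ x)
  star₂ : ∀ x, T₂ (star x) = star (T₂ x)
  orth₁₂ : ∀ x y, T₁ x * T₂ y = 0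
  orth₂₁ : ∀ x y, T₂ y * T₁ x = 0

theorem OrthMaps.symm {T₁ : B₁ →L[ℂ] B} {T₂ : B₂ →L[ℂ] B} (h : OrthMaps T₁ T₂) :
    OrthMaps T₂ T₁ :=
  ⟨h.mul₂, h.mul₁, h.star₂, h.star₁, fun x y => h.orth₂₁ y x, fun x y => h.orth₁₂ y x⟩

theorem coe_injective : Function.Injective (DoubleCentralizer.coe ℂ : B → 𝓜(ℂ, B)) := by
  intro a b h
  have h1 : ∀ x : B, a * x = b * x := fun x => by
    have := congrArg (fun m : 𝓜(ℂ, B) => m.fst x) h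
    simpa using this
  have h2 : (a - b) * star (a - b) = 0 := by rw [sub_mul, h1, sub_self]
  exact sub_eq_zero.1 (CStarRing.mul_star_self_eq_zero_iff _ |>.1 h2)

theorem IsometryPair.orth (S : IsometryPair B) : star S.s₁ * S.s₂ = 0 := by
  have h1 : star S.s₁ * (S.s₁ * star S.s₁ + S.s₂ * star S.s₂) * S.s₂ = star S.s₁ * S.s₂ := by
    rw [S.sum_eq_one, mul_one]
  have h2 : star S.s₁ * (S.s₁ * star S.s₁ + S.s₂ * star S.s₂) * S.s₂ =
      (star S.s₁ * S.s₁) * (star S.s₁ * S.s₂) + (star S.s₁ * S.s₂) * (star S.s₂ * S.s₂) := by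
    noncomm_ring
  rw [h1, S.isometry₁, S.isometry₂, one_mul, mul_one] at h2
  simpa using h2

theorem IsometryPair.orthMaps (S : IsometryPair B) : OrthMaps (conjBy S.s₁) (conjBy S.s₂) := by
  have cm : ∀ x y : B, DoubleCentralizer.coe ℂ (x * y) =
      DoubleCentralizer.coe ℂ x * DoubleCentralizer.coe ℂ y :=
    map_mul (DoubleCentralizer.coeHom (𝕜 := ℂ) (A := B))
  have cs : ∀ x : B, DoubleCentralizer.coe ℂ (star x) = star (DoubleCentralizer.coe ℂ x) :=
    map_star (DoubleCentralizer.coeHom (𝕜 := ℂ) (A := B))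
  have c0 : DoubleCentralizer.coe ℂ (0 : B) = 0 :=
    map_zero (DoubleCentralizer.coeHom (𝕜 := ℂ) (A := B))
  have hm : ∀ (m : 𝓜(ℂ, B)), star m * m = 1 → ∀ x y,
      conjBy m (x * y) = conjBy m x * conjBy m y := fun m hm x y => coe_injective <| by
    rw [coe_conjBy, cm, cm, coe_conjBy, coe_conjBy]
    calc m * (DoubleCentralizer.coe ℂ x * DoubleCentralizer.coe ℂ y) * star m
        = m * DoubleCentralizer.coe ℂ x * 1 * DoubleCentralizer.coe ℂ y * star m := by
          noncomm_ring
      _ = _ := by rw [← hm]; noncomm_ring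
  have hs : ∀ (m : 𝓜(ℂ, B)) (x : B), conjBy m (star x) = star (conjBy m x) := fun m x =>
    coe_injective <| by
      rw [coe_conjBy, cs, cs, coe_conjBy, star_mul, star_mul, star_star, mul_assoc]
  have ho : ∀ (m n : 𝓜(ℂ, B)), star m * n = 0 → ∀ x y, conjBy m x * conjBy n y = 0 :=
    fun m n hmn x y => coe_injective <| by
      rw [cm, coe_conjBy, coe_conjBy, c0]
      calc _ = m * DoubleCentralizer.coe ℂ x * (star m * n) * DoubleCentralizer.coe ℂ y *
            star n := by noncomm_ring
        _ = 0 := by rw [hmn]; noncomm_ring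
  have h21 : star S.s₂ * S.s₁ = 0 := by
    have := congrArg star S.orth
    simpa using this
  exact ⟨hm _ S.isometry₁, hm _ S.isometry₂, hs _, hs _, ho _ _ S.orth,
    fun x y => ho _ _ h21 y x⟩

/-- Pointwise application of a map `B₁ → B`. -/
noncomputable def pt (T : B₁ →L[ℂ] B) : Cb B₁ →L[ℂ] Cb B := T.compLeftContinuousBounded ℝ≥0

@[simp] theorem pt_apply (T : B₁ →L[ℂ] B) (f : Cb B₁) (t : ℝ≥0) : pt T f t = T (f t) := rfl

theorem Vanishes.pt {f : Cb B₁} (hf : Vanishes f) (T : B₁ →L[ℂ] B) : Vanishes (pt T f) := by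
  have := (T.continuous.tendsto 0).comp hf
  simpa [Vanishes, Function.comp_def] using this

theorem Vanishes.add {f g : Cb B} (hf : Vanishes f) (hg : Vanishes g) : Vanishes (f + g) := by
  simpa [Vanishes] using Tendsto.add hf hg

theorem isClosed_vanishes : IsClosed {f : Cb B | Vanishes f} := by
  refine isClosed_of_closure_subset fun f hf => ?_
  rw [Set.mem_ofPred_eq, Vanishes, Metric.tendsto_nhds]
  intro ε hε
  obtain ⟨g, hg, hfg⟩ := Metric.mem_closure_iff.1 hf (ε / 2) (half_pos hε)
  filter_upwards [Metric.tendsto_nhds.1 hg (ε / 2) (half_pos hε)] with t ht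
  calc dist (f t) 0 ≤ dist (f t) (g t) + dist (g t) 0 := dist_triangle _ _ _
    _ < ε / 2 + ε / 2 := add_lt_add_of_le_of_lt
        ((BoundedContinuousFunction.dist_coe_le_dist t).trans hfg.le) ht
    _ = ε := add_halves ε

/-- The `*`-homomorphism `(x, y) ↦ T₁ x + T₂ y`. -/
noncomputable def OrthMaps.hom {T₁ : B₁ →L[ℂ] B} {T₂ : B₂ →L[ℂ] B} (h : OrthMaps T₁ T₂) :
    (Cb B₁ × Cb B₂) →⋆ₙₐ[ℂ] Cb B where
  toFun q := pt T₁ q.1 + pt T₂ q.2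
  map_smul' z q := by simp
  map_zero' := by simp
  map_add' q r := by simp only [Prod.fst_add, Prod.snd_add, map_add]; abel
  map_mul' q r := by
    ext t
    simp [h.mul₁, h.mul₂, mul_add, add_mul, h.orth₁₂, h.orth₂₁]
  map_star' q := by
    ext t
    simp [h.star₁, h.star₂]

theorem OrthMaps.hom_continuous {T₁ : B₁ →L[ℂ] B} {T₂ : B₂ →L[ℂ] B} (h : OrthMaps T₁ T₂) :
    Continuous h.hom :=
  ((pt T₁).continuous.comp continuous_fst).add ((pt T₂).continuous.comp continuous_snd)

theorem OrthMaps.vanishes_hom {T₁ : B₁ →L[ℂ] B} {T₂ : B₂ →L[ℂ] B} (h : OrthMaps T₁ T₂)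
    {x : Cb B₁} {y : Cb B₂} (hx : Vanishes x) (hy : Vanishes y) : Vanishes (h.hom (x, y)) :=
  (hx.pt T₁).add (hy.pt T₂)

variable {A : Type u}

theorem algE_hom_le {T₁ : B₁ →L[ℂ] B} {T₂ : B₂ →L[ℂ] B} (h : OrthMaps T₁ T₂)
    (Φp Φm : A → Cb B₁) (Ψp Ψm : A → Cb B₂) {e : Cb B}
    (he : e ∈ algE (fun a => h.hom (Φp a, Ψp a)) (fun a => h.hom (Φm a, Ψm a))) :
    e ∈ closure (h.hom '' {q | q.1 ∈ algE Φp Φm ∧ q.2 ∈ algE Ψp Ψm}) := by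
  have hsub : ∀ {C : Type v} [NonUnitalCStarAlgebra C] (f g : A → Cb C) (a : A),
      f a ∈ algE f g ∧ g a ∈ algE f g := fun f g a =>
    ⟨NonUnitalStarSubalgebra.le_topologicalClosure _
      (NonUnitalStarAlgebra.subset_adjoin ℂ _ (Or.inl ⟨a, rfl⟩)),
     NonUnitalStarSubalgebra.le_topologicalClosure _
      (NonUnitalStarAlgebra.subset_adjoin ℂ _ (Or.inr ⟨a, rfl⟩))⟩
  have key : algE (fun a => h.hom (Φp a, Ψp a)) (fun a => h.hom (Φm a, Ψm a)) ≤
      (((algE Φp Φm).prod (algE Ψp Ψm)).map h.hom).topologicalClosure := by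
    refine NonUnitalStarSubalgebra.topologicalClosure_mono
      (NonUnitalStarAlgebra.adjoin_le ?_)
    rintro _ (⟨a, rfl⟩ | ⟨a, rfl⟩)
    · exact ⟨(Φp a, Ψp a), ⟨(hsub Φp Φm a).1, (hsub Ψp Ψm a).1⟩, rfl⟩
    · exact ⟨(Φm a, Ψm a), ⟨(hsub Φp Φm a).2, (hsub Ψp Ψm a).2⟩, rfl⟩
  exact key he

theorem idealD_spec {C : Type v} [NonUnitalCStarAlgebra C] (f g : A → Cb C) :
    (∀ a, f a - g a ∈ idealD f g) ∧
      ∀ e ∈ algE f g, ∀ x ∈ idealD f g, e * x ∈ idealD f g ∧ x * e ∈ idealD f g := by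
  refine ⟨fun a => ?_, fun e he x hx => ⟨?_, ?_⟩⟩
  · exact (Submodule.mem_sInf).2 fun S hS => hS.2.1 a
  · exact (Submodule.mem_sInf).2 fun S hS =>
      (hS.2.2 e he x ((Submodule.mem_sInf).1 hx S hS)).1
  · exact (Submodule.mem_sInf).2 fun S hS =>
      (hS.2.2 e he x ((Submodule.mem_sInf).1 hx S hS)).2

theorem idealD_hom_le {T₁ : B₁ →L[ℂ] B} {T₂ : B₂ →L[ℂ] B} (h : OrthMaps T₁ T₂)
    (Φp Φm : A → Cb B₁) (Ψp Ψm : A → Cb B₂) {x : Cb B}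
    (hx : x ∈ idealD (fun a => h.hom (Φp a, Ψp a)) (fun a => h.hom (Φm a, Ψm a))) :
    x ∈ closure (h.hom '' {q | q.1 ∈ idealD Φp Φm ∧ q.2 ∈ idealD Ψp Ψm}) := by
  let L : (Cb B₁ × Cb B₂) →ₗ[ℂ] Cb B := (h.hom : (Cb B₁ × Cb B₂) →ₗ[ℂ] Cb B)
  let S : Submodule ℂ (Cb B) :=
    (((idealD Φp Φm).prod (idealD Ψp Ψm)).map L).topologicalClosure
  suffices hS : x ∈ S from hS
  refine (Submodule.mem_sInf).1 hx S ⟨Submodule.isClosed_topologicalClosure _, fun a => ?_,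
    fun e he y hy => ⟨?_, ?_⟩⟩
  · refine Submodule.le_topologicalClosure _
      ⟨(Φp a - Φm a, Ψp a - Ψm a), ⟨(idealD_spec Φp Φm).1 a, (idealD_spec Ψp Ψm).1 a⟩, ?_⟩
    exact map_sub h.hom (Φp a, Ψp a) (Φm a, Ψm a)
  · refine map_mem_closure₂ continuous_mul (algE_hom_le h Φp Φm Ψp Ψm he) hy ?_
    rintro _ ⟨q, hq, rfl⟩ _ ⟨r, hr, rfl⟩
    exact ⟨q * r, ⟨((idealD_spec Φp Φm).2 _ hq.1 _ hr.1).1,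
      ((idealD_spec Ψp Ψm).2 _ hq.2 _ hr.2).1⟩, map_mul h.hom q r⟩
  · refine map_mem_closure₂ (f := fun a b => b * a) (by fun_prop)
      (algE_hom_le h Φp Φm Ψp Ψm he) hy ?_
    rintro _ ⟨q, hq, rfl⟩ _ ⟨r, hr, rfl⟩
    exact ⟨r * q, ⟨((idealD_spec Φp Φm).2 _ hq.1 _ hr.1).2,
      ((idealD_spec Ψp Ψm).2 _ hq.2 _ hr.2).2⟩, map_mul h.hom r q⟩

theorem vanishes_mul_of_hom {T₁ : B₁ →L[ℂ] B} {T₂ : B₂ →L[ℂ] B} (h : OrthMaps T₁ T₂)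
    {Φp Φm : A → Cb B₁} {Ψp Ψm : A → Cb B₂} {m : Cb B₁} {n : Cb B₂}
    (hm : ∀ x ∈ idealD Φp Φm, Vanishes (m * x)) (hn : ∀ x ∈ idealD Ψp Ψm, Vanishes (n * x))
    {x : Cb B} (hx : x ∈ idealD (fun a => h.hom (Φp a, Ψp a)) (fun a => h.hom (Φm a, Ψm a))) :
    Vanishes (h.hom (m, n) * x) := by
  have hcl : IsClosed {y : Cb B | Vanishes (h.hom (m, n) * y)} :=
    isClosed_vanishes.preimage (continuous_const.mul continuous_id)
  refine closure_minimal ?_ hcl (idealD_hom_le h Φp Φm Ψp Ψm hx)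
  rintro _ ⟨q, hq, rfl⟩
  show Vanishes (h.hom (m, n) * h.hom q)
  rw [← map_mul]
  exact h.vanishes_hom (hm _ hq.1) (hn _ hq.2)

variable [NonUnitalCStarAlgebra A]

theorem IsCompactCycle.hom {T₁ : B₁ →L[ℂ] B} {T₂ : B₂ →L[ℂ] B} (h : OrthMaps T₁ T₂)
    {Φp Φm : A → Cb B₁} {Ψp Ψm : A → Cb B₂} (hΦ : IsCompactCycle Φp Φm)
    (hΨ : IsCompactCycle Ψp Ψm) :
    IsCompactCycle (fun a => h.hom (Φp a, Ψp a)) (fun a => h.hom (Φm a, Ψm a)) where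
  continuous_pos := h.hom_continuous.comp (hΦ.continuous_pos.prodMk hΨ.continuous_pos)
  continuous_neg := h.hom_continuous.comp (hΦ.continuous_neg.prodMk hΨ.continuous_neg)
  smul_pos z a := by rw [hΦ.smul_pos, hΨ.smul_pos, ← map_smul]; rfl
  smul_neg z a := by rw [hΦ.smul_neg, hΨ.smul_neg, ← map_smul]; rfl
  star_pos a := by
    rw [← map_star, ← map_sub]; exact h.vanishes_hom (hΦ.star_pos a) (hΨ.star_pos a)
  star_neg a := by
    rw [← map_star, ← map_sub]; exact h.vanishes_hom (hΦ.star_neg a) (hΨ.star_neg a)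
  add_pos a b x hx := by
    rw [← map_sub, ← map_sub]; exact vanishes_mul_of_hom h (hΦ.add_pos a b) (hΨ.add_pos a b) hx
  add_neg a b x hx := by
    rw [← map_sub, ← map_sub]; exact vanishes_mul_of_hom h (hΦ.add_neg a b) (hΨ.add_neg a b) hx
  mul_pos a b x hx := by
    rw [← map_mul, ← map_sub]; exact vanishes_mul_of_hom h (hΦ.mul_pos a b) (hΨ.mul_pos a b) hx
  mul_neg a b x hx := by
    rw [← map_mul, ← map_sub]; exact vanishes_mul_of_hom h (hΦ.mul_neg a b) (hΨ.mul_neg a b) hx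

theorem isAsympHom_hom {T₁ : B₁ →L[ℂ] B} {T₂ : B₂ →L[ℂ] B} (h : OrthMaps T₁ T₂)
    {φ : A → Cb B₁} {ψ : A → Cb B₂} (hφ : IsAsympHom φ) (hψ : IsAsympHom ψ) :
    IsAsympHom (fun a => h.hom (φ a, ψ a)) where
  continuous := h.hom_continuous.comp (hφ.continuous.prodMk hψ.continuous)
  map_smul z a := by rw [hφ.map_smul, hψ.map_smul, ← map_smul h.hom]; rfl
  map_star a := by
    rw [← map_star h.hom, ← map_sub]
    exact h.vanishes_hom (hφ.map_star a) (hψ.map_star a)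
  map_add a b := by
    rw [← map_sub, ← map_sub]; exact h.vanishes_hom (hφ.map_add a b) (hψ.map_add a b)
  map_mul a b := by
    rw [← map_mul h.hom, ← map_sub]
    exact h.vanishes_hom (hφ.map_mul a b) (hψ.map_mul a b)

theorem OrthMaps.lift₁ {T₁ T₂ : B →L[ℂ] B} (h : OrthMaps T₁ T₂) :
    OrthMaps (T₁.compLeftContinuous ℂ unitInterval)
      ((ContinuousLinearMap.const ℂ unitInterval).comp T₂) where
  mul₁ x y := by ext τ; exact h.mul₁ _ _
  mul₂ x y := by ext τ; exact h.mul₂ _ _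
  star₁ x := by ext τ; exact h.star₁ _
  star₂ x := by ext τ; exact h.star₂ _
  orth₁₂ x y := by ext τ; exact h.orth₁₂ _ _
  orth₂₁ x y := by ext τ; exact h.orth₂₁ _ _

theorem OrthMaps.lift₂ {T₁ T₂ : B →L[ℂ] B} (h : OrthMaps T₁ T₂) :
    OrthMaps ((ContinuousLinearMap.const ℂ unitInterval).comp T₁)
      (T₂.compLeftContinuous ℂ unitInterval) :=
  h.symm.lift₁.symm

end Maps

section Add

variable {A : Type u} [NonUnitalCStarAlgebra A] {B : Type v} [NonUnitalCStarAlgebra B]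

/-- `f ⊕ g = s₁ f s₁* + s₂ g s₂*` in `C_b(ℝ₊; B)`. -/
noncomputable def IsometryPair.sum (S : IsometryPair B) (f g : Cb B) : Cb B :=
  pt (conjBy S.s₁) f + pt (conjBy S.s₂) g

/-- The sum of two compact asymptotic `KK`-cycles. -/
noncomputable def CompactCycle.add (S : IsometryPair B) (Φ Ψ : CompactCycle A B) :
    CompactCycle A B where
  pos a := S.sum (Φ.pos a) (Ψ.pos a)
  neg a := S.sum (Φ.neg a) (Ψ.neg a)
  isCycle := Φ.isCycle.hom S.orthMaps Ψ.isCycle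

/-- The addition on `EM(A, B)`. -/
noncomputable def EM.add (S : IsometryPair B) : EM A B → EM A B → EM A B :=
  Quot.map₂ (CompactCycle.add S)
    (fun Φ _ _ ⟨Θ, h⟩ => ⟨⟨_, _, Φ.isCycle.hom S.orthMaps.lift₂ Θ.isCycle⟩, fun a t =>
      ⟨congrArg (fun b => conjBy S.s₁ (Φ.pos a t) + conjBy S.s₂ b) (h a t).1,
       congrArg (fun b => conjBy S.s₁ (Φ.neg a t) + conjBy S.s₂ b) (h a t).2.1,
       congrArg (fun b => conjBy S.s₁ (Φ.pos a t) + conjBy S.s₂ b) (h a t).2.2.1,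
       congrArg (fun b => conjBy S.s₁ (Φ.neg a t) + conjBy S.s₂ b) (h a t).2.2.2⟩⟩)
    (fun _ _ Φ ⟨Θ, h⟩ => ⟨⟨_, _, Θ.isCycle.hom S.orthMaps.lift₁ Φ.isCycle⟩, fun a t =>
      ⟨congrArg (fun b => conjBy S.s₁ b + conjBy S.s₂ (Φ.pos a t)) (h a t).1,
       congrArg (fun b => conjBy S.s₁ b + conjBy S.s₂ (Φ.neg a t)) (h a t).2.1,
       congrArg (fun b => conjBy S.s₁ b + conjBy S.s₂ (Φ.pos a t)) (h a t).2.2.1,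
       congrArg (fun b => conjBy S.s₁ b + conjBy S.s₂ (Φ.neg a t)) (h a t).2.2.2⟩⟩)

variable {X X' Y Y' : SepExt.{u, w} A}

/-- The sum of two pairs of asymptotic homomorphisms from `C`. -/
noncomputable def Pair.add (S : IsometryPair B) (ψ φ : Pair X B) : Pair X B where
  pos c := S.sum (ψ.pos c) (φ.pos c)
  neg c := S.sum (ψ.neg c) (φ.neg c)
  isAsympHom_pos := isAsympHom_hom S.orthMaps ψ.isAsympHom_pos φ.isAsympHom_pos
  isAsympHom_neg := isAsympHom_hom S.orthMaps ψ.isAsympHom_neg φ.isAsympHom_neg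
  agree c hc := by rw [ψ.agree c hc, φ.agree c hc]

/-- The addition on `EN(C, J; B)`. -/
noncomputable def ENJ.add (S : IsometryPair B) : ENJ X B → ENJ X B → ENJ X B :=
  Quot.map₂ (Pair.add S)
    (fun φ _ _ ⟨θ, h⟩ =>
      ⟨⟨_, _, isAsympHom_hom S.orthMaps.lift₂ φ.isAsympHom_pos θ.isAsympHom_pos,
        isAsympHom_hom S.orthMaps.lift₂ φ.isAsympHom_neg θ.isAsympHom_neg,
        fun c hc => by rw [φ.agree c hc, θ.agree c hc]⟩, fun a t =>
      ⟨congrArg (fun b => conjBy S.s₁ (φ.pos a t) + conjBy S.s₂ b) (h a t).1,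
       congrArg (fun b => conjBy S.s₁ (φ.neg a t) + conjBy S.s₂ b) (h a t).2.1,
       congrArg (fun b => conjBy S.s₁ (φ.pos a t) + conjBy S.s₂ b) (h a t).2.2.1,
       congrArg (fun b => conjBy S.s₁ (φ.neg a t) + conjBy S.s₂ b) (h a t).2.2.2⟩⟩)
    (fun _ _ φ ⟨θ, h⟩ =>
      ⟨⟨_, _, isAsympHom_hom S.orthMaps.lift₁ θ.isAsympHom_pos φ.isAsympHom_pos,
        isAsympHom_hom S.orthMaps.lift₁ θ.isAsympHom_neg φ.isAsympHom_neg,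
        fun c hc => by rw [φ.agree c hc, θ.agree c hc]⟩, fun a t =>
      ⟨congrArg (fun b => conjBy S.s₁ b + conjBy S.s₂ (φ.pos a t)) (h a t).1,
       congrArg (fun b => conjBy S.s₁ b + conjBy S.s₂ (φ.neg a t)) (h a t).2.1,
       congrArg (fun b => conjBy S.s₁ b + conjBy S.s₂ (φ.pos a t)) (h a t).2.2.1,
       congrArg (fun b => conjBy S.s₁ b + conjBy S.s₂ (φ.neg a t)) (h a t).2.2.2⟩⟩)

/-- The pull-back `{(c, d) : p(c) = q(d)}` of two surjections onto `A`. -/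
noncomputable def pullbackAlg (X Y : SepExt.{u, w} A) : NonUnitalStarSubalgebra ℂ (X.C × Y.C) :=
  NonUnitalStarAlgHom.equalizer (X.p.comp (NonUnitalStarAlgHom.fst ℂ X.C Y.C))
    (Y.p.comp (NonUnitalStarAlgHom.snd ℂ X.C Y.C))

theorem mem_pullbackAlg {q : X.C × Y.C} : q ∈ pullbackAlg X Y ↔ X.p q.1 = Y.p q.2 := Iff.rfl

instance isClosed_pullbackAlg : IsClosed (pullbackAlg X Y : Set (X.C × Y.C)) :=
  isClosed_eq ((map_continuous X.p).comp continuous_fst)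
    ((map_continuous Y.p).comp continuous_snd)

/-- The pull-back of two objects of `𝓔_A`, an upper bound for both. -/
noncomputable def SepExt.pull (X Y : SepExt.{u, w} A) : SepExt.{u, w} A where
  C := pullbackAlg X Y
  cstar := NonUnitalStarSubalgebra.nonUnitalCStarAlgebra (pullbackAlg X Y)
  separable := by
    have := UniformSpace.secondCountable_of_separable X.C
    have := UniformSpace.secondCountable_of_separable Y.C
    infer_instance
  p := (X.p.comp (NonUnitalStarAlgHom.fst ℂ X.C Y.C)).comp
    (NonUnitalStarSubalgebraClass.subtype (pullbackAlg X Y))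
  surjective a := by
    obtain ⟨c, hc⟩ := X.surjective a
    obtain ⟨d, hd⟩ := Y.surjective a
    exact ⟨⟨(c, d), hc.trans hd.symm⟩, hc⟩

/-- The projection of the pull-back onto the first algebra. -/
noncomputable def SepExt.fst (X Y : SepExt.{u, w} A) : SepExt.Hom (X.pull Y) X where
  toHom := (NonUnitalStarAlgHom.fst ℂ X.C Y.C).comp
    (NonUnitalStarSubalgebraClass.subtype (pullbackAlg X Y))
  surjective c := by
    obtain ⟨d, hd⟩ := Y.surjective (X.p c)
    exact ⟨⟨(c, d), hd.symm⟩, rfl⟩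
  comm _ := rfl

/-- The projection of the pull-back onto the second algebra. -/
noncomputable def SepExt.snd (X Y : SepExt.{u, w} A) : SepExt.Hom (X.pull Y) Y where
  toHom := (NonUnitalStarAlgHom.snd ℂ X.C Y.C).comp
    (NonUnitalStarSubalgebraClass.subtype (pullbackAlg X Y))
  surjective d := by
    obtain ⟨c, hc⟩ := X.surjective (Y.p d)
    exact ⟨⟨(c, d), hc⟩, rfl⟩
  comm c := c.2.symm

/-- Functoriality of the pull-back. -/
noncomputable def SepExt.Hom.pull (κ : SepExt.Hom X' X) (μ : SepExt.Hom Y' Y) :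
    SepExt.Hom (X'.pull Y') (X.pull Y) where
  toHom := NonUnitalStarAlgHom.codRestrict
    ((NonUnitalStarAlgHom.prod (κ.toHom.comp (NonUnitalStarAlgHom.fst ℂ X'.C Y'.C))
      (μ.toHom.comp (NonUnitalStarAlgHom.snd ℂ X'.C Y'.C))).comp
      (NonUnitalStarSubalgebraClass.subtype (pullbackAlg X' Y'))) (pullbackAlg X Y)
    fun c => (κ.comm c.1.1).trans (c.2.trans (μ.comm c.1.2).symm)
  surjective := by
    rintro ⟨⟨c, d⟩, h⟩
    obtain ⟨c', hc⟩ := κ.surjective c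
    obtain ⟨d', hd⟩ := μ.surjective d
    refine ⟨⟨(c', d'), ?_⟩, Subtype.ext (Prod.ext hc hd)⟩
    rw [mem_pullbackAlg, ← κ.comm, ← μ.comm, hc, hd]
    exact h
  comm c := κ.comm c.1.1

/-- The identity. -/
def SepExt.Hom.id (X : SepExt.{u, w} A) : SepExt.Hom X X where
  toHom := NonUnitalStarAlgHom.id ℂ X.C
  surjective c := ⟨c, rfl⟩
  comm _ := rfl

/-- The addition on the direct limit `EN(A, B)`: two elements are pulled back to a common `C` and
added there. -/
noncomputable def EN.add (S : IsometryPair B) : EN A B → EN A B → EN A B :=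
  Quot.map₂
    (fun x y => ⟨x.1.pull y.1, ENJ.add S (ENJ.pullback (x.1.fst y.1) x.2)
      (ENJ.pullback (x.1.snd y.1) y.2)⟩)
    (by
      rintro ⟨X, x⟩ ⟨Y, y⟩ ⟨Y', y'⟩ ⟨μ, h⟩
      dsimp only at μ h
      subst h
      refine ⟨(SepExt.Hom.id X).pull μ, ?_⟩
      induction x using Quot.ind
      induction y using Quot.ind
      rfl)
    (by
      rintro ⟨X, x⟩ ⟨X', x'⟩ ⟨Y, y⟩ ⟨κ, h⟩
      dsimp only at κ h
      subst h
      refine ⟨κ.pull (SepExt.Hom.id Y), ?_⟩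
      induction x using Quot.ind
      induction y using Quot.ind
      rfl)

end Add

end AsympKK

/-!
The map `γ` restricts a pair `(ψ⁺, ψ⁻)` on `C` along a section `s : A → C`, and its inverse extends
a compact asymptotic `KK`-cycle `(Φ⁺, Φ⁻)` to a pair on a suitable separable algebra over `A`.

Sections exist by the Bartle–Graves theorem, averaged over the unit circle and over the involution
(`SepExt.exists_isSection`). The defects of `s` lie in `J = ker p`, and `ψ⁺(J) = ψ⁻(J)` annihilates
`D` modulo `C_0(ℝ₊; B)`, because `ψ⁺(j) (ψ⁺(c) - ψ⁻(c)) ∼ ψ⁺(jc) - ψ⁻(jc) = 0` for `j ∈ J`. So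
`ψ ∘ s` is a compact cycle (`isCompactCycle_comp`). Two sections are joined by affine paths, to
which the same argument applies in the algebra of paths in `C`; hence `γ` is well defined.

For the inverse, let `C_Φ` be the `C*`-subalgebra of `A × C_b(ℝ₊; B)` generated by the graph of
`Φ⁺`, and put `ψ⁺(a, e) = e` and `ψ⁻(a, e) = e - Φ⁺(a) + Φ⁻(a)` (`CompactCycle.toPair`). The two
maps agree where `a = 0`, and they restrict to `Φ⁺` and `Φ⁻` along the section `a ↦ (a, Φ⁺(a))`. The
map `ψ⁺` is a `*`-homomorphism. That `ψ⁻` is an asymptotic homomorphism rests on two facts about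
the annihilator of `D` in `E` modulo `C_0(ℝ₊; B)`. It contains `e - Φ⁺(a)` for all `(a, e)` in `C_Φ`
(`CompactCycle.graphAlg_le_hull`), and it meets `D` in `C_0(ℝ₊; B)`
(`IsCompactCycle.vanishes_of_mem`), so that `Φ⁺` and `Φ⁻` have asymptotically the same defects.

In the direct limit a pair may be pulled back along any `*`-homomorphism over `A`, surjective or not
(`EN.mk_comp`): the mapping cylinder maps onto both algebras, and its paths are a homotopy between
the two pull-backs. This makes the class of `(C_Φ, ψ)` invariant under homotopies of `Φ`. For
`Φ = ψ ∘ s` it identifies the class with that of the given pair, since both pull back to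
asymptotically equal pairs on the algebra of all `(c, (a, e))` in `C × C_Φ` with `p(c) = a` and
`e ∼ ψ⁺(c)`.
-/

namespace AsympKK

open Filter
open scoped Topology NNReal BoundedContinuousFunction MultiplierAlgebra CStarAlgebra

/-! ### The Bartle–Graves theorem and sections -/

section BartleGraves

variable {E F : Type*} [NormedAddCommGroup E] [NormedSpace ℂ E] [CompleteSpace E]
  [NormedAddCommGroup F] [NormedSpace ℂ F] [CompleteSpace F]

/-- A bounded approximate right inverse of a surjection, obtained by gluing local constant choices
with a partition of unity away from the origin. -/
theorem exists_continuous_approx_preimage (p : E →L[ℂ] F) (hp : Function.Surjective p) :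
    ∃ K : ℝ, 0 ≤ K ∧ ∃ g : F → E, Continuous g ∧ (∀ y, ‖g y‖ ≤ K * ‖y‖) ∧
      ∀ y, ‖y - p (g y)‖ ≤ ‖y‖ / 2 := by
  classical
  obtain ⟨K, hK, hpre⟩ := p.exists_preimage_norm_le hp
  -- The constant `2 * K` leaves room for a preimage of `y₀` to serve all `y` near `y₀`.
  let t : {y : F // y ≠ 0} → Set E := fun y =>
    {c | ‖c‖ ≤ 2 * K * ‖(y : F)‖} ∩ {c | ‖(y : F) - p c‖ ≤ ‖(y : F)‖ / 2}
  have ht : ∀ y, Convex ℝ (t y) := by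
    intro y
    refine Convex.inter ?_ ?_
    · simpa [Metric.closedBall, dist_zero_right] using
        convex_closedBall (0 : E) (2 * K * ‖(y : F)‖)
    · have := (convex_closedBall (y : F) (‖(y : F)‖ / 2)).is_linear_preimage
        (f := p) (p.restrictScalars ℝ).toLinearMap.isLinear
      simpa [Set.preimage, Metric.closedBall, dist_eq_norm, norm_sub_rev] using this
  obtain ⟨g, hg⟩ := exists_continuous_forall_mem_convex_of_local_const ht (fun y₀ => by
    obtain ⟨c, hc, hcn⟩ := hpre y₀
    have hpos : 0 < ‖(y₀ : F)‖ := norm_pos_iff.2 y₀.2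
    have hcont : Continuous fun y : {y : F // y ≠ 0} => (y : F) := continuous_subtype_val
    refine ⟨c, ?_⟩
    have h1 : ∀ᶠ y : {y : F // y ≠ 0} in 𝓝 y₀, ‖(y₀ : F)‖ < 2 * ‖(y : F)‖ :=
      (continuous_const.tendsto y₀).eventually_lt
        ((continuous_const.mul hcont.norm).tendsto y₀) (by
          change ‖(y₀ : F)‖ < 2 * ‖(y₀ : F)‖
          linarith)
    have h2 : ∀ᶠ y : {y : F // y ≠ 0} in 𝓝 y₀, ‖(y : F) - p c‖ < ‖(y : F)‖ / 2 :=
      ((hcont.sub continuous_const).norm.tendsto y₀).eventually_lt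
        ((hcont.norm.div_const 2).tendsto y₀) (by simpa [hc] using hpos)
    filter_upwards [h1, h2] with y hy1 hy2
    exact ⟨hcn.trans (by nlinarith), hy2.le⟩)
  refine ⟨2 * K, by positivity, fun y => if h : y ≠ 0 then g ⟨y, h⟩ else 0, ?_,
    fun y => ?_, fun y => ?_⟩
  · refine continuous_iff_continuousAt.2 fun y => ?_
    by_cases hy : y = 0
    · subst hy
      rw [ContinuousAt, dif_neg (not_not.2 rfl)]
      refine squeeze_zero_norm (a := fun y : F => 2 * K * ‖y‖) (fun y => ?_) ?_
      · split_ifs with h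
        · exact (hg ⟨y, h⟩).1
        · simpa using (by positivity : 0 ≤ 2 * K * ‖y‖)
      · simpa using (tendsto_norm_zero (E := F)).const_mul (2 * K)
    · have hopen : IsOpen {y : F | y ≠ 0} := isOpen_ne
      refine ContinuousOn.continuousAt (s := {y : F | y ≠ 0}) ?_ (hopen.mem_nhds hy)
      rw [continuousOn_iff_continuous_domRestrict]
      have hres : {y : F | y ≠ 0}.domRestrict
          (fun y => if h : y ≠ 0 then g ⟨y, h⟩ else 0) = g := by
        funext z
        exact dif_pos z.2
      rw [hres]
      exact g.continuous
  · dsimp only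
    split_ifs with h
    · exact (hg ⟨y, h⟩).1
    · simpa using (by positivity : 0 ≤ 2 * K * ‖y‖)
  · dsimp only
    split_ifs with h
    · exact (hg ⟨y, h⟩).2
    · rw [not_not] at h
      simp [h]

/-- The Bartle–Graves theorem. The section is the series obtained by applying an approximate right
inverse `g` successively to the remainders `y ↦ y - p (g y)`, which shrink geometrically. -/
theorem exists_continuous_section (p : E →L[ℂ] F) (hp : Function.Surjective p) :
    ∃ K : ℝ, ∃ s : F → E, Continuous s ∧ (∀ y, ‖s y‖ ≤ K * ‖y‖) ∧ ∀ y, p (s y) = y := by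
  obtain ⟨K, hK, g, hg, hgn, hgp⟩ := exists_continuous_approx_preimage p hp
  let r : F → F := fun y => y - p (g y)
  have hr : Continuous r := continuous_id.sub (p.continuous.comp hg)
  have hrn : ∀ n y, ‖r^[n] y‖ ≤ ‖y‖ * (1 / 2) ^ n := by
    intro n
    induction n with
    | zero => simp
    | succ n ih =>
      intro y
      rw [Function.iterate_succ_apply', pow_succ]
      have h1 : ‖r (r^[n] y)‖ ≤ ‖r^[n] y‖ / 2 := hgp _
      linarith [ih y]
  have hterm : ∀ n y, ‖g (r^[n] y)‖ ≤ K * ‖y‖ * (1 / 2) ^ n := fun n y =>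
    calc ‖g (r^[n] y)‖ ≤ K * ‖r^[n] y‖ := hgn _
      _ ≤ K * (‖y‖ * (1 / 2) ^ n) := mul_le_mul_of_nonneg_left (hrn n y) hK
      _ = _ := by ring
  have hsum : ∀ y : F, Summable fun n => K * ‖y‖ * (1 / 2 : ℝ) ^ n := fun y =>
    summable_geometric_two.mul_left _
  have hsg : ∀ y, Summable fun n => g (r^[n] y) := fun y =>
    Summable.of_norm_bounded (hsum y) fun n => hterm n y
  refine ⟨2 * K, fun y => ∑' n, g (r^[n] y), ?_, fun y => ?_, fun y => ?_⟩
  · refine continuous_iff_continuousAt.2 fun y => ?_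
    have hball : Metric.ball (0 : F) (‖y‖ + 1) ∈ 𝓝 y :=
      Metric.isOpen_ball.mem_nhds (by simp)
    refine ContinuousOn.continuousAt (s := Metric.ball (0 : F) (‖y‖ + 1)) ?_ hball
    refine continuousOn_tsum (u := fun n => K * (‖y‖ + 1) * (1 / 2 : ℝ) ^ n)
      (fun n => (hg.comp (hr.iterate n)).continuousOn)
      (summable_geometric_two.mul_left _) fun n z hz => (hterm n z).trans ?_
    rw [Metric.mem_ball, dist_zero_right] at hz
    gcongr
  · refine tsum_of_norm_bounded (g := fun n => K * ‖y‖ * (1 / 2 : ℝ) ^ n) ?_ (fun n => hterm n y)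
    have := (hasSum_geometric_two).mul_left (K * ‖y‖)
    rwa [mul_right_comm, mul_comm K 2] at this
  · have h1 : HasSum (fun n => p (g (r^[n] y))) (p (∑' n, g (r^[n] y))) :=
      (hsg y).hasSum.mapL p
    have h2 : ∀ n, ∑ i ∈ Finset.range n, p (g (r^[i] y)) = y - r^[n] y := by
      intro n
      induction n with
      | zero => simp
      | succ n ih =>
        rw [Finset.sum_range_succ, ih, Function.iterate_succ_apply']
        simp only [r]
        abel
    have h3 : Tendsto (fun n => y - r^[n] y) atTop (𝓝 y) := by
      have h4 : Tendsto (fun n => r^[n] y) atTop (𝓝 0) := by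
        refine squeeze_zero_norm (fun n => hrn n y) ?_
        simpa using (tendsto_pow_atTop_nhds_zero_of_lt_one (r := (1 / 2 : ℝ))
          (by norm_num) (by norm_num)).const_mul ‖y‖
      simpa using tendsto_const_nhds.sub h4
    refine tendsto_nhds_unique h1.tendsto_sum_nat ?_
    simpa only [h2] using h3

/-- A homogeneous Bartle–Graves section: a bounded section `s` is averaged to
`h y = (2π)⁻¹ ∫ ζ⁻¹ s (ζ y)` over the unit circle, which makes it equivariant under rotations, and
then extended from the unit sphere by real homogeneity. -/
theorem exists_continuous_homogeneous_section (p : E →L[ℂ] F) (hp : Function.Surjective p) :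
    ∃ s : F → E, Continuous s ∧ (∀ (z : ℂ) (y : F), s (z • y) = z • s y) ∧ ∀ y, p (s y) = y := by
  obtain ⟨K, s, hs, hsn, hsp⟩ := exists_continuous_section p hp
  have hpi : (2 * Real.pi) ≠ 0 := by positivity
  let ζ : ℝ → ℂ := fun θ => Complex.exp (θ * Complex.I)
  have hζ : Continuous ζ := by fun_prop
  have hζ1 : ∀ θ, ‖ζ θ‖ = 1 := Complex.norm_exp_ofReal_mul_I
  have hζ0 : ∀ θ, ζ θ ≠ 0 := fun θ => Complex.exp_ne_zero _
  have hζadd : ∀ θ α, ζ (θ + α) = ζ θ * ζ α := fun θ α => by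
    simp only [ζ, ← Complex.exp_add]; push_cast; ring_nf
  let k : F → ℝ → E := fun y θ => (ζ θ)⁻¹ • s (ζ θ • y)
  have hk : Continuous k.uncurry := by
    have h1 : Continuous fun q : F × ℝ => (ζ q.2)⁻¹ :=
      (hζ.comp continuous_snd).inv₀ fun q => hζ0 _
    exact h1.smul (hs.comp ((hζ.comp continuous_snd).smul continuous_fst))
  have hky : ∀ y, Continuous (k y) := fun y => hk.comp (Continuous.prodMk_right y)
  let h : F → E := fun y => (2 * Real.pi)⁻¹ • ∫ θ in (0 : ℝ)..2 * Real.pi, k y θ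
  have hh : Continuous h :=
    (intervalIntegral.continuous_parametric_intervalIntegral_of_continuous' hk _ _).const_smul _
  have hhn : ∀ y, ‖h y‖ ≤ K * ‖y‖ := fun y => by
    have h1 : ‖∫ θ in (0 : ℝ)..2 * Real.pi, k y θ‖ ≤ K * ‖y‖ * |2 * Real.pi - 0| :=
      intervalIntegral.norm_integral_le_of_norm_le_const fun θ _ => by
        simpa [k, norm_smul, hζ1] using hsn (ζ θ • y)
    have h2 : |2 * Real.pi - 0| = 2 * Real.pi := by
      rw [sub_zero, abs_of_pos Real.two_pi_pos]
    rw [norm_smul, norm_inv, Real.norm_of_nonneg Real.two_pi_pos.le, inv_mul_le_iff₀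
      Real.two_pi_pos]
    rw [h2] at h1
    linarith
  have hhp : ∀ y, p (h y) = y := fun y => by
    have h1 : p (∫ θ in (0 : ℝ)..2 * Real.pi, k y θ) =
        ∫ θ in (0 : ℝ)..2 * Real.pi, p (k y θ) :=
      (p.intervalIntegral_comp_comm ((hky y).intervalIntegrable _ _)).symm
    have h2 : ∀ θ, p (k y θ) = y := fun θ => by
      simp [k, hsp, smul_smul, inv_mul_cancel₀ (hζ0 θ)]
    have h3 : p (h y) = (2 * Real.pi)⁻¹ • p (∫ θ in (0 : ℝ)..2 * Real.pi, k y θ) :=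
      map_smul (p.restrictScalars ℝ) _ _
    rw [h3, h1]
    simp only [h2, intervalIntegral.integral_const, sub_zero, smul_smul, inv_mul_cancel₀ hpi,
      one_smul]
  have hrot : ∀ α y, h (ζ α • y) = ζ α • h y := fun α y => by
    have h1 : ∀ θ, k (ζ α • y) θ = ζ α • k y (θ + α) := fun θ => by
      simp only [k, smul_smul, hζadd]
      congr 1
      field_simp [hζ0]
    have hper : Function.Periodic (k y) (2 * Real.pi) := fun θ => by
      have : ζ (θ + 2 * Real.pi) = ζ θ := by
        rw [hζadd]
        simp [ζ, Complex.exp_two_pi_mul_I]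
      simp only [k, this]
    have h2 : ∫ θ in (0 : ℝ)..2 * Real.pi, k y (θ + α) = ∫ θ in (0 : ℝ)..2 * Real.pi, k y θ := by
      rw [intervalIntegral.integral_comp_add_right (k y) α, zero_add, add_comm (2 * Real.pi)]
      simpa using hper.intervalIntegral_add_eq α 0
    simp only [h, h1, intervalIntegral.integral_smul, h2]
    exact smul_comm _ _ _
  clear_value h
  refine ⟨fun y => (‖y‖ : ℂ) • h ((‖y‖ : ℂ)⁻¹ • y), ?_, fun z y => ?_, fun y => ?_⟩
  · refine continuous_iff_continuousAt.2 fun y => ?_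
    by_cases hy : y = 0
    -- The bound on `h` gives continuity at the origin, where `‖y‖⁻¹` is not continuous.
    · subst hy
      rw [ContinuousAt]
      simp only [norm_zero, Complex.ofReal_zero, zero_smul]
      refine squeeze_zero_norm (a := fun y : F => K * ‖y‖) (fun y => ?_) ?_
      · rcases eq_or_ne y 0 with rfl | hy
        · simp
        have h1 := hhn ((‖y‖ : ℂ)⁻¹ • y)
        have hy' : ‖y‖ ≠ 0 := norm_ne_zero_iff.2 hy
        rw [norm_smul, norm_inv, Complex.norm_real, norm_norm, inv_mul_cancel₀ hy', mul_one] at h1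
        rw [norm_smul, Complex.norm_real, norm_norm, mul_comm]
        exact mul_le_mul_of_nonneg_right h1 (norm_nonneg _)
      · simpa using (tendsto_norm_zero (E := F)).const_mul K
    · have h1 : ContinuousAt (fun y : F => (‖y‖ : ℂ)) y :=
        (Complex.continuous_ofReal.comp continuous_norm).continuousAt
      have h2 : ContinuousAt (fun y : F => (‖y‖ : ℂ)⁻¹ • y) y :=
        (h1.inv₀ (by simpa using hy)).smul continuousAt_id
      exact h1.smul (hh.continuousAt.comp h2)
  · rcases eq_or_ne z 0 with rfl | hz
    · simp
    have hz' : (‖z‖ : ℂ) ≠ 0 := by simpa using hz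
    have hpol : z = ‖z‖ * ζ z.arg := (Complex.norm_mul_exp_arg_mul_I z).symm
    have h1 : (‖z • y‖ : ℂ)⁻¹ • z • y = ζ z.arg • (‖y‖ : ℂ)⁻¹ • y := by
      rw [norm_smul, smul_smul, smul_smul]
      congr 1
      nth_rewrite 2 [hpol]
      push_cast
      rw [mul_inv, mul_comm (‖z‖ : ℂ)⁻¹, mul_assoc, inv_mul_cancel_left₀ hz', mul_comm]
    beta_reduce
    rw [h1, hrot, norm_smul, smul_smul, smul_smul]
    congr 1
    nth_rewrite 3 [hpol]
    push_cast
    ring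
  · rcases eq_or_ne y 0 with rfl | hy
    · simp
    have hy' : (‖y‖ : ℂ) ≠ 0 := by simpa using hy
    rw [map_smul, hhp, smul_smul, mul_inv_cancel₀ hy', one_smul]

end BartleGraves

/-- A homogeneous section `s` becomes compatible with the involution when it is averaged with
`a ↦ s(a*)*`. -/
theorem SepExt.exists_isSection {A : Type u} [NonUnitalCStarAlgebra A] (X : SepExt.{u, w} A) :
    ∃ s : A → X.C, X.IsSection s := by
  let p : X.C →L[ℂ] A :=
    { toFun := X.p
      map_add' := map_add X.p
      map_smul' := map_smul X.p
      cont := map_continuous X.p }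
  obtain ⟨s, hs, hsz, hsp⟩ := exists_continuous_homogeneous_section p X.surjective
  replace hsp : ∀ a, X.p (s a) = a := hsp
  refine ⟨fun a => (2 : ℂ)⁻¹ • (s a + star (s (star a))), ?_, fun z a => ?_, fun a => ?_,
    fun a => ?_⟩
  · exact (hs.add (hs.comp continuous_star).star).const_smul _
  · rw [star_smul, hsz, hsz, star_smul, star_star, ← smul_add, smul_comm]
  · simp [star_smul, star_add, add_comm]
  · rw [map_smul, map_add, map_star, hsp, hsp, star_star, ← two_smul ℂ a, smul_smul]
    norm_num

/-! ### Functions that vanish at infinity and homotopies of asymptotic homomorphisms -/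

section Vanishing

variable {B : Type v} [NonUnitalCStarAlgebra B]

theorem vanishes_iff_norm {f : Cb B} : Vanishes f ↔ Tendsto (fun t => ‖f t‖) atTop (𝓝 0) :=
  tendsto_zero_iff_norm_tendsto_zero

theorem vanishes_zero : Vanishes (0 : Cb B) := tendsto_const_nhds

theorem Vanishes.neg {f : Cb B} (hf : Vanishes f) : Vanishes (-f) := by
  simpa [Vanishes] using Tendsto.neg hf

theorem Vanishes.sub {f g : Cb B} (hf : Vanishes f) (hg : Vanishes g) : Vanishes (f - g) := by
  simpa [Vanishes] using Tendsto.sub hf hg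

theorem Vanishes.smul {f : Cb B} (hf : Vanishes f) (z : ℂ) : Vanishes (z • f) := by
  simpa [Vanishes] using Tendsto.const_smul hf z

theorem Vanishes.star {f : Cb B} (hf : Vanishes f) : Vanishes (star f) := by
  simpa [Vanishes] using Tendsto.star hf

theorem Vanishes.mul_left {f : Cb B} (hf : Vanishes f) (g : Cb B) : Vanishes (g * f) := by
  rw [vanishes_iff_norm] at hf ⊢
  refine squeeze_zero (fun _ => norm_nonneg _) (fun t => ?_) (by simpa using hf.const_mul ‖g‖)
  exact (norm_mul_le _ _).trans (mul_le_mul_of_nonneg_right (g.norm_coe_le_norm t) (norm_nonneg _))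

theorem Vanishes.mul_right {f : Cb B} (hf : Vanishes f) (g : Cb B) : Vanishes (f * g) := by
  simpa using (hf.star.mul_left (Star.star g)).star

theorem vanishes_of_star_mul_self {f : Cb B} (hf : Vanishes (star f * f)) : Vanishes f := by
  rw [vanishes_iff_norm] at hf ⊢
  have h : ∀ t, ‖(star f * f) t‖ = ‖f t‖ ^ 2 := fun t => by
    rw [sq]; exact CStarRing.norm_star_mul_self
  simp only [h] at hf
  simpa using hf.sqrt

theorem Vanishes.congr {f g : Cb B} (hf : Vanishes f) (h : Vanishes (g - f)) : Vanishes g := by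
  simpa using h.add hf

end Vanishing

section Swap

variable {B : Type v} [NonUnitalCStarAlgebra B]

/-- A continuous path in `C_b(ℝ₊; B)`, seen as an element of `C_b(ℝ₊; IB)`. -/
noncomputable def swap (g : C(unitInterval, Cb B)) : Cb (IB B) :=
  BoundedContinuousFunction.ofNormedAddCommGroup
    (ContinuousMap.curry (X := ℝ≥0) (Y := unitInterval)
      ⟨fun q => g q.2 q.1, by fun_prop⟩)
    (ContinuousMap.continuous _) ‖g‖ fun t =>
      (ContinuousMap.norm_le _ (norm_nonneg g)).2 fun τ =>
        ((g τ).norm_coe_le_norm t).trans (g.norm_coe_le_norm τ)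

@[simp] theorem swap_apply (g : C(unitInterval, Cb B)) (t : ℝ≥0) (τ : unitInterval) :
    swap g t τ = g τ t := rfl

theorem swap_sub (g h : C(unitInterval, Cb B)) : swap (g - h) = swap g - swap h := rfl

theorem continuous_swap : Continuous (swap : C(unitInterval, Cb B) → Cb (IB B)) := by
  refine LipschitzWith.continuous (K := 1) (LipschitzWith.of_dist_le_mul fun g h => ?_)
  rw [NNReal.coe_one, one_mul, dist_eq_norm, dist_eq_norm, ← swap_sub]
  exact (BoundedContinuousFunction.norm_le (norm_nonneg _)).2 fun t =>
    (ContinuousMap.norm_le _ (norm_nonneg _)).2 fun τ =>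
      (((g - h) τ).norm_coe_le_norm t).trans ((g - h).norm_coe_le_norm τ)

/-- A norm-continuous path of functions that tend to zero at infinity does so uniformly, because
the unit interval is compact. -/
theorem vanishes_swap {g : C(unitInterval, Cb B)} (hg : ∀ τ, Vanishes (g τ)) :
    Vanishes (swap g) := by
  rw [vanishes_iff_norm, Metric.tendsto_nhds]
  intro ε hε
  have key : ∀ τ₀ : unitInterval, ∃ U ∈ 𝓝 τ₀, ∀ᶠ t in atTop, ∀ τ ∈ U, ‖g τ t‖ ≤ ε / 2 := by
    intro τ₀
    refine ⟨g ⁻¹' Metric.ball (g τ₀) (ε / 4), g.continuous.continuousAt.preimage_mem_nhds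
      (Metric.ball_mem_nhds _ (by positivity)), ?_⟩
    filter_upwards [Metric.tendsto_nhds.1 (hg τ₀) (ε / 4) (by positivity)] with t ht τ hτ
    rw [dist_zero_right] at ht
    have h1 : ‖g τ t - g τ₀ t‖ < ε / 4 := by
      rw [← dist_eq_norm]
      exact (BoundedContinuousFunction.dist_coe_le_dist t).trans_lt hτ
    have h2 := norm_le_norm_add_norm_sub' (g τ t) (g τ₀ t)
    linarith
  choose U hU hUt using key
  obtain ⟨T, -, hT⟩ := isCompact_univ.elim_nhds_subcover U fun τ _ => hU τ
  filter_upwards [(Filter.eventually_all_finset T).2 fun τ _ => hUt τ] with t ht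
  rw [dist_zero_right, norm_norm]
  refine lt_of_le_of_lt ((ContinuousMap.norm_le _ (by positivity)).2 fun τ => ?_)
    (half_lt_self hε)
  obtain ⟨i, hi, hτ⟩ := Set.mem_iUnion₂.1 (hT (Set.mem_univ τ))
  exact ht i hi τ hτ

/-- The evaluation of paths at `τ`, on `C_b(ℝ₊; IB)`. -/
noncomputable def evalAt (τ : unitInterval) : Cb (IB B) →⋆ₙₐ[ℂ] Cb B where
  toFun f := pt (ContinuousMap.evalCLM ℂ τ) f
  map_smul' _ _ := rfl
  map_zero' := rfl
  map_add' _ _ := rfl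
  map_mul' _ _ := rfl
  map_star' _ := rfl

theorem continuous_evalAt (τ : unitInterval) :
    Continuous (evalAt τ : Cb (IB B) → Cb B) :=
  (pt (ContinuousMap.evalCLM ℂ τ)).continuous

theorem Vanishes.evalAt {f : Cb (IB B)} (hf : Vanishes f) (τ : unitInterval) :
    Vanishes (evalAt τ f) :=
  hf.pt (ContinuousMap.evalCLM ℂ τ)

end Swap

section AsympHom

variable {A : Type u} [NonUnitalCStarAlgebra A] {B : Type v} [NonUnitalCStarAlgebra B]

/-- A continuous homogeneous map that is asymptotically equal to an asymptotic homomorphism is one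
itself. -/
theorem IsAsympHom.congr {φ ψ : A → Cb B} (hφ : IsAsympHom φ) (hc : Continuous ψ)
    (hs : ∀ (z : ℂ) (a : A), ψ (z • a) = z • ψ a) (h : ∀ a, Vanishes (ψ a - φ a)) :
    IsAsympHom ψ where
  continuous := hc
  map_smul := hs
  map_star a := by
    have : ψ (star a) - star (ψ a) = (ψ (star a) - φ (star a)) + (φ (star a) - star (φ a)) -
        star (ψ a - φ a) := by rw [star_sub]; abel
    rw [this]
    exact ((h _).add (hφ.map_star a)).sub (h a).star
  map_add a b := by
    have : ψ (a + b) - ψ a - ψ b = (ψ (a + b) - φ (a + b)) + (φ (a + b) - φ a - φ b) -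
        (ψ a - φ a) - (ψ b - φ b) := by abel
    rw [this]
    exact (((h _).add (hφ.map_add a b)).sub (h a)).sub (h b)
  map_mul a b := by
    have : ψ (a * b) - ψ a * ψ b = (ψ (a * b) - φ (a * b)) + (φ (a * b) - φ a * φ b) -
        (ψ a - φ a) * φ b - ψ a * (ψ b - φ b) := by noncomm_ring
    rw [this]
    exact (((h _).add (hφ.map_mul a b)).sub ((h a).mul_right _)).sub ((h b).mul_left _)

theorem IsAsympHom.map_neg {φ : A → Cb B} (hφ : IsAsympHom φ) (a : A) : φ (-a) = -φ a := by
  simpa using hφ.map_smul (-1) a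

theorem IsAsympHom.map_sub {φ : A → Cb B} (hφ : IsAsympHom φ) (a b : A) :
    Vanishes (φ (a - b) - (φ a - φ b)) := by
  have := hφ.map_add a (-b)
  rw [hφ.map_neg, ← sub_eq_add_neg] at this
  convert this using 1
  abel

theorem IsAsympHom.comp_starHom {C : Type w} [NonUnitalCStarAlgebra C] {φ : A → Cb B}
    (hφ : IsAsympHom φ) (f : C →⋆ₙₐ[ℂ] A) : IsAsympHom fun c => φ (f c) where
  continuous := hφ.continuous.comp (map_continuous f)
  map_smul z c := by rw [_root_.map_smul, hφ.map_smul]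
  map_star c := by rw [StarHomClass.map_star]; exact hφ.map_star _
  map_add c d := by rw [_root_.map_add]; exact hφ.map_add _ _
  map_mul c d := by rw [_root_.map_mul]; exact hφ.map_mul _ _

/-- A continuous family of asymptotic homomorphisms to `B`, parametrised by the unit interval, is
an asymptotic homomorphism to `IB`. -/
theorem isAsympHom_swap {φ : A → C(unitInterval, Cb B)} (hc : Continuous φ)
    (h : ∀ τ, IsAsympHom fun a => φ a τ) : IsAsympHom fun a => swap (φ a) where
  continuous := continuous_swap.comp hc
  map_smul z a := by
    ext t τ
    exact congrArg (fun f : Cb B => f t) ((h τ).map_smul z a)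
  map_star a := vanishes_swap (g := φ (star a) - star (φ a)) fun τ => (h τ).map_star a
  map_add a b := vanishes_swap (g := φ (a + b) - φ a - φ b) fun τ => (h τ).map_add a b
  map_mul a b := vanishes_swap (g := φ (a * b) - φ a * φ b) fun τ => (h τ).map_mul a b

/-- The extension of a continuous map `φ : A → C_b(ℝ₊; B)` to paths in `A`. -/
noncomputable def onPaths (φ : A → Cb B) (hφ : Continuous φ) (f : C(unitInterval, A)) :
    Cb (IB B) :=
  swap ((⟨φ, hφ⟩ : C(A, Cb B)).comp f)

@[simp] theorem onPaths_apply (φ : A → Cb B) (hφ : Continuous φ) (f : C(unitInterval, A))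
    (t : ℝ≥0) (τ : unitInterval) : onPaths φ hφ f t τ = φ (f τ) t := rfl

theorem IsAsympHom.onPaths {φ : A → Cb B} (hφ : IsAsympHom φ) :
    IsAsympHom (onPaths φ hφ.continuous) where
  continuous := continuous_swap.comp (ContinuousMap.continuous_postcomp _)
  map_smul z f := by
    ext t τ
    exact congrArg (fun f : Cb B => f t) (hφ.map_smul z (f τ))
  map_star f := vanishes_swap
    (g := (⟨φ, hφ.continuous⟩ : C(A, Cb B)).comp (star f) -
      star ((⟨φ, hφ.continuous⟩ : C(A, Cb B)).comp f)) fun τ => hφ.map_star (f τ)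
  map_add f g := vanishes_swap
    (g := (⟨φ, hφ.continuous⟩ : C(A, Cb B)).comp (f + g) -
      (⟨φ, hφ.continuous⟩ : C(A, Cb B)).comp f - (⟨φ, hφ.continuous⟩ : C(A, Cb B)).comp g)
    fun τ => hφ.map_add (f τ) (g τ)
  map_mul f g := vanishes_swap
    (g := (⟨φ, hφ.continuous⟩ : C(A, Cb B)).comp (f * g) -
      (⟨φ, hφ.continuous⟩ : C(A, Cb B)).comp f * (⟨φ, hφ.continuous⟩ : C(A, Cb B)).comp g)
    fun τ => hφ.map_mul (f τ) (g τ)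

/-- The affine path from `x` to `y`. -/
noncomputable def affinePath {V : Type*} [NormedAddCommGroup V] [NormedSpace ℂ V] (x y : V) :
    C(unitInterval, V) :=
  ⟨fun τ => (1 - (τ : ℝ) : ℂ) • x + ((τ : ℝ) : ℂ) • y, by fun_prop⟩

theorem affinePath_apply {V : Type*} [NormedAddCommGroup V] [NormedSpace ℂ V] (x y : V)
    (τ : unitInterval) : affinePath x y τ = (1 - (τ : ℝ) : ℂ) • x + ((τ : ℝ) : ℂ) • y := rfl

@[simp] theorem affinePath_zero {V : Type*} [NormedAddCommGroup V] [NormedSpace ℂ V] (x y : V) :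
    affinePath x y 0 = x := by simp [affinePath_apply]

@[simp] theorem affinePath_one {V : Type*} [NormedAddCommGroup V] [NormedSpace ℂ V] (x y : V) :
    affinePath x y 1 = y := by simp [affinePath_apply]

theorem continuous_affinePath {X V : Type*} [TopologicalSpace X] [NormedAddCommGroup V]
    [NormedSpace ℂ V] {f g : X → V} (hf : Continuous f) (hg : Continuous g) :
    Continuous fun x => affinePath (f x) (g x) := by
  refine ContinuousMap.continuous_of_continuous_uncurry _ ?_
  simp only [Function.uncurry_def, affinePath_apply]
  fun_prop

theorem affinePath_smul {V : Type*} [NormedAddCommGroup V] [NormedSpace ℂ V] (z : ℂ) (x y : V) :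
    affinePath (z • x) (z • y) = z • affinePath x y := by
  ext τ
  simp [affinePath_apply, smul_comm z]

/-- The straight-line homotopy between asymptotically equal pairs. -/
theorem Pair.homotopic_of_vanishes {X : SepExt.{u, w} A} {ψ φ : Pair X B}
    (hp : ∀ c, Vanishes (φ.pos c - ψ.pos c)) (hn : ∀ c, Vanishes (φ.neg c - ψ.neg c)) :
    Pair.Homotopic ψ φ := by
  have key : ∀ f g : X.C → Cb B, IsAsympHom f → IsAsympHom g → (∀ c, Vanishes (g c - f c)) →
      IsAsympHom fun c => swap (affinePath (f c) (g c)) := fun f g hf hg h =>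
    isAsympHom_swap (continuous_affinePath hf.continuous hg.continuous) fun τ =>
      hf.congr ((continuous_eval_const τ).comp (continuous_affinePath hf.continuous hg.continuous))
        (fun z c => by rw [hf.map_smul, hg.map_smul, affinePath_smul]; rfl)
        (fun c => by
          convert (h c).smul (τ : ℝ) using 1
          rw [affinePath_apply, sub_smul, one_smul, smul_sub]
          abel)
  refine ⟨⟨_, _, key _ _ ψ.isAsympHom_pos φ.isAsympHom_pos hp,
    key _ _ ψ.isAsympHom_neg φ.isAsympHom_neg hn,
    fun c hc => by rw [ψ.agree c hc, φ.agree c hc]⟩, fun c t => ?_⟩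
  simp

end AsympHom

/-! ### From pairs of asymptotic homomorphisms to compact cycles -/

section Restriction

variable {A : Type u} [NonUnitalCStarAlgebra A] {B : Type v} [NonUnitalCStarAlgebra B]

/-- A closed set that contains all `Φ⁺(a)` and `Φ⁻(a)` and is stable under the operations of a
`*`-algebra contains `E`. -/
theorem algE_induction {A : Type u} {Φp Φm : A → Cb B} {S : Set (Cb B)} (hS : IsClosed S)
    (h0 : (0 : Cb B) ∈ S) (hadd : ∀ x ∈ S, ∀ y ∈ S, x + y ∈ S)
    (hsmul : ∀ (z : ℂ), ∀ x ∈ S, z • x ∈ S)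
    (hmul : ∀ x ∈ S, ∀ y ∈ S, x * y ∈ S) (hstar : ∀ x ∈ S, star x ∈ S)
    (hp : ∀ a, Φp a ∈ S) (hm : ∀ a, Φm a ∈ S) {e : Cb B} (he : e ∈ algE Φp Φm) : e ∈ S := by
  let K : NonUnitalStarSubalgebra ℂ (Cb B) :=
    { carrier := S
      add_mem' := fun hx hy => hadd _ hx _ hy
      zero_mem' := h0
      smul_mem' := fun z _ hx => hsmul z _ hx
      mul_mem' := fun hx hy => hmul _ hx _ hy
      star_mem' := fun hx => hstar _ hx }
  have hle : NonUnitalStarAlgebra.adjoin ℂ (Set.range Φp ∪ Set.range Φm) ≤ K :=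
    NonUnitalStarAlgebra.adjoin_le (by rintro _ (⟨a, rfl⟩ | ⟨a, rfl⟩); exacts [hp a, hm a])
  exact NonUnitalStarSubalgebra.topologicalClosure_minimal _ hle hS he

/-- If `ψ⁺` and `ψ⁻` agree on the ideal `J`, then `ψ⁺(J)` annihilates the ideal `D`
asymptotically: `ψ⁺(j) (ψ⁺(c) - ψ⁻(c)) ∼ ψ⁺(j c) - ψ⁻(j c) = 0`. -/
theorem vanishes_mul_of_mem_idealD {C : Type w} [NonUnitalCStarAlgebra C] {A : Type u}
    {ψp ψm : C → Cb B} (hp : IsAsympHom ψp) (hm : IsAsympHom ψm) {J : Set C}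
    (hJmul : ∀ j ∈ J, ∀ c, j * c ∈ J) (hJ : ∀ j ∈ J, ψp j = ψm j) (s : A → C) {j : C}
    (hj : j ∈ J) {x : Cb B} (hx : x ∈ idealD (fun a => ψp (s a)) (fun a => ψm (s a))) :
    Vanishes (ψp j * x) := by
  let S : Submodule ℂ (Cb B) :=
    { carrier := {x | ∀ j ∈ J, Vanishes (ψp j * x)}
      add_mem' := fun hx hy j hj => by rw [mul_add]; exact (hx j hj).add (hy j hj)
      zero_mem' := fun j _ => by rw [mul_zero]; exact vanishes_zero
      smul_mem' := fun z x hx j hj => by rw [mul_smul_comm]; exact (hx j hj).smul z }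
  suffices h : x ∈ S from h j hj
  have hScl : IsClosed (S : Set (Cb B)) := by
    have : (S : Set (Cb B)) = ⋂ j ∈ J, {x | Vanishes (ψp j * x)} := by ext; simp [S]
    rw [this]
    exact isClosed_biInter fun j _ =>
      isClosed_vanishes.preimage (continuous_const.mul continuous_id)
  have hpmul : ∀ c, ∀ x ∈ S, ψp c * x ∈ S := fun c x hx j hj => by
    have : ψp j * (ψp c * x) = ψp (j * c) * x - (ψp (j * c) - ψp j * ψp c) * x := by
      noncomm_ring
    rw [this]
    exact (hx _ (hJmul j hj c)).sub ((hp.map_mul j c).mul_right _)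
  have hmmul : ∀ c, ∀ x ∈ S, ψm c * x ∈ S := fun c x hx j hj => by
    have : ψp j * (ψm c * x) = ψp (j * c) * x - (ψm (j * c) - ψm j * ψm c) * x := by
      rw [hJ j hj, hJ _ (hJmul j hj c)]; noncomm_ring
    rw [this]
    exact (hx _ (hJmul j hj c)).sub ((hm.map_mul j c).mul_right _)
  have hvan : ∀ f : Cb B, Vanishes f → ∀ x, f * x ∈ S := fun f hf x j _ =>
    (hf.mul_right x).mul_left _
  have hstar : ∀ ψ : C → Cb B, IsAsympHom ψ → (∀ c, ∀ x ∈ S, ψ c * x ∈ S) →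
      ∀ c, ∀ x ∈ S, star (ψ c) * x ∈ S := fun ψ hψ h c x hx => by
    have : star (ψ c) * x = ψ (star c) * x - (ψ (star c) - star (ψ c)) * x := by noncomm_ring
    rw [this]
    exact S.sub_mem (h _ _ hx) (hvan _ (hψ.map_star c) x)
  refine (Submodule.mem_sInf).1 hx S ⟨hScl, fun a j hj => ?_, fun e he x hx => ⟨?_, ?_⟩⟩
  · have : ψp j * (ψp (s a) - ψm (s a)) = (ψm (j * s a) - ψm j * ψm (s a)) -
        (ψp (j * s a) - ψp j * ψp (s a)) := by
      rw [hJ _ (hJmul j hj _), hJ j hj]; noncomm_ring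
    rw [this]
    exact (hm.map_mul _ _).sub (hp.map_mul _ _)
  -- The multipliers of `S` have to be required together with their adjoints, since `E` is generated
  -- as a `*`-algebra.
  · refine (algE_induction (S := {e | (∀ x ∈ S, e * x ∈ S) ∧ ∀ x ∈ S, star e * x ∈ S})
      ?_ ?_ ?_ ?_ ?_ ?_ ?_ ?_ he).1 x hx
    · have : {e : Cb B | (∀ x ∈ S, e * x ∈ S) ∧ ∀ x ∈ S, star e * x ∈ S} =
          ⋂ x ∈ S, ({e | e * x ∈ S} ∩ {e | star e * x ∈ S}) := by
        ext e
        simp only [Set.mem_ofPred_eq, Set.mem_iInter, Set.mem_inter_iff]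
        exact ⟨fun h x hx => ⟨h.1 x hx, h.2 x hx⟩,
          fun h => ⟨fun x hx => (h x hx).1, fun x hx => (h x hx).2⟩⟩
      rw [this]
      exact isClosed_biInter fun x _ =>
        (hScl.preimage (continuous_id.mul continuous_const)).inter
          (hScl.preimage (continuous_star.mul continuous_const))
    · simp
    · exact fun e he f hf =>
        ⟨fun x hx => by rw [add_mul]; exact S.add_mem (he.1 x hx) (hf.1 x hx),
         fun x hx => by rw [star_add, add_mul]; exact S.add_mem (he.2 x hx) (hf.2 x hx)⟩
    · exact fun z e he =>
        ⟨fun x hx => by rw [smul_mul_assoc]; exact S.smul_mem _ (he.1 x hx),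
         fun x hx => by rw [star_smul, smul_mul_assoc]; exact S.smul_mem _ (he.2 x hx)⟩
    · exact fun e he f hf =>
        ⟨fun x hx => by rw [mul_assoc]; exact he.1 _ (hf.1 x hx),
         fun x hx => by rw [star_mul, mul_assoc]; exact hf.2 _ (he.2 x hx)⟩
    · exact fun e he => ⟨he.2, by simpa using he.1⟩
    · exact fun a => ⟨hpmul _, hstar ψp hp hpmul _⟩
    · exact fun a => ⟨hmmul _, hstar ψm hm hmmul _⟩
  · intro j hj
    rw [← mul_assoc]
    exact (hx j hj).mul_right e

/-- The composition of a pair of asymptotic homomorphisms that agree on a right ideal `J` with a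
map that is a `*`-homomorphism modulo `J` is a compact asymptotic `KK`-cycle. The map need not
respect the involution, as long as `ψ⁺` does not see its defect. -/
theorem isCompactCycle_comp {C : Type w} [NonUnitalCStarAlgebra C]
    {ψp ψm : C → Cb B} (hp : IsAsympHom ψp) (hm : IsAsympHom ψm) {J : Set C}
    (hJmul : ∀ j ∈ J, ∀ c, j * c ∈ J) (hJ : ∀ j ∈ J, ψp j = ψm j) {s : A → C}
    (hs : Continuous s) (hsmul : ∀ (z : ℂ) a, s (z • a) = z • s a)
    (hstar : ∀ a, s (star a) - star (s a) ∈ J)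
    (hstar' : ∀ a, Vanishes (ψp (s (star a) - star (s a))))
    (hadd : ∀ a b, s (a + b) - s a - s b ∈ J) (hmul : ∀ a b, s (a * b) - s a * s b ∈ J) :
    IsCompactCycle (fun a => ψp (s a)) (fun a => ψm (s a)) := by
  have kstar : ∀ ψ : C → Cb B, IsAsympHom ψ → (∀ j ∈ J, ψp j = ψ j) → ∀ a,
      Vanishes (ψ (s (star a)) - star (ψ (s a))) := fun ψ hψ h a => by
    refine ((((hstar' a).sub (hψ.map_sub (s (star a)) (star (s a)))).add
      (hψ.map_star (s a)))).congr ?_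
    rw [h _ (hstar a)]
    convert vanishes_zero using 1
    abel
  have kadd : ∀ ψ : C → Cb B, IsAsympHom ψ → (∀ j ∈ J, ψp j = ψ j) → ∀ a b,
      ∀ x ∈ idealD (fun a => ψp (s a)) (fun a => ψm (s a)),
      Vanishes ((ψ (s (a + b)) - ψ (s a) - ψ (s b)) * x) := fun ψ hψ h a b x hx => by
    have h1 := vanishes_mul_of_mem_idealD hp hm hJmul hJ s (hadd a b) hx
    have h2 := ((hψ.map_sub (s (a + b) - s a) (s b)).add
      (hψ.map_sub (s (a + b)) (s a))).mul_right x
    refine (h1.sub h2).congr ?_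
    rw [h _ (hadd a b)]
    convert vanishes_zero using 1
    noncomm_ring
  have kmul : ∀ ψ : C → Cb B, IsAsympHom ψ → (∀ j ∈ J, ψp j = ψ j) → ∀ a b,
      ∀ x ∈ idealD (fun a => ψp (s a)) (fun a => ψm (s a)),
      Vanishes ((ψ (s (a * b)) - ψ (s a) * ψ (s b)) * x) := fun ψ hψ h a b x hx => by
    have h1 := vanishes_mul_of_mem_idealD hp hm hJmul hJ s (hmul a b) hx
    have h2 := ((hψ.map_sub (s (a * b)) (s a * s b)).sub
      (hψ.map_mul (s a) (s b))).mul_right x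
    refine (h1.sub h2).congr ?_
    rw [h _ (hmul a b)]
    convert vanishes_zero using 1
    noncomm_ring
  exact
    { continuous_pos := hp.continuous.comp hs
      continuous_neg := hm.continuous.comp hs
      smul_pos := fun z a => by rw [hsmul, hp.map_smul]
      smul_neg := fun z a => by rw [hsmul, hm.map_smul]
      star_pos := kstar ψp hp fun _ _ => rfl
      star_neg := kstar ψm hm hJ
      add_pos := kadd ψp hp fun _ _ => rfl
      add_neg := kadd ψm hm hJ
      mul_pos := kmul ψp hp fun _ _ => rfl
      mul_neg := kmul ψm hm hJ }

/-- `s` is a continuous homogeneous section of `p : C → A` that respects the involution up to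
elements which `ψ⁺`, equivalently `ψ⁻`, maps to zero asymptotically. -/
structure Pair.IsQuasiSection {X : SepExt.{u, w} A} (ψ : Pair X B) (s : A → X.C) : Prop where
  continuous : Continuous s
  map_smul : ∀ (z : ℂ) (a : A), s (z • a) = z • s a
  map_star : ∀ a : A, Vanishes (ψ.pos (s (star a) - star (s a)))
  right_inv : ∀ a : A, X.p (s a) = a

theorem SepExt.IsSection.isQuasiSection {X : SepExt.{u, w} A} {s : A → X.C}
    (hs : X.IsSection s) (ψ : Pair X B) : ψ.IsQuasiSection s where
  continuous := hs.continuous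
  map_smul := hs.map_smul
  map_star a := by
    have h := ψ.isAsympHom_pos.map_smul 0 0
    rw [zero_smul, zero_smul] at h
    rw [hs.map_star, sub_self, h]
    exact vanishes_zero
  right_inv := hs.right_inv

theorem Pair.IsQuasiSection.isCompactCycle {X : SepExt.{u, w} A} {ψ : Pair X B} {s : A → X.C}
    (hs : ψ.IsQuasiSection s) :
    IsCompactCycle (fun a => ψ.pos (s a)) (fun a => ψ.neg (s a)) :=
  isCompactCycle_comp (J := {c | X.p c = 0}) ψ.isAsympHom_pos ψ.isAsympHom_neg
    (fun j hj c => by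
      rw [Set.mem_ofPred_eq] at hj ⊢
      rw [map_mul, hj, zero_mul])
    ψ.agree hs.continuous hs.map_smul
    (fun a => by simp [hs.right_inv, StarHomClass.map_star]) hs.map_star
    (fun a b => by simp [hs.right_inv]) (fun a b => by simp [hs.right_inv])

/-- The compact asymptotic `KK`-cycle `(ψ⁺ ∘ s, ψ⁻ ∘ s)`. -/
def Pair.IsQuasiSection.cycle {X : SepExt.{u, w} A} {ψ : Pair X B} {s : A → X.C}
    (hs : ψ.IsQuasiSection s) : CompactCycle A B :=
  ⟨_, _, hs.isCompactCycle⟩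

/-- Any two sections give homotopic cycles: the affine path between them is a section of the
algebra of paths in `C`. -/
theorem Pair.IsQuasiSection.homotopic {X : SepExt.{u, w} A} {ψ : Pair X B} {s₀ s₁ : A → X.C}
    (h₀ : ψ.IsQuasiSection s₀) (h₁ : ψ.IsQuasiSection s₁) :
    CompactCycle.Homotopic h₀.cycle h₁.cycle := by
  have hp : ∀ a (τ : unitInterval), X.p (affinePath (s₀ a) (s₁ a) τ) = a := fun a τ => by
    rw [affinePath_apply, map_add, _root_.map_smul, _root_.map_smul, h₀.right_inv, h₁.right_inv,
      ← add_smul, sub_add_cancel, one_smul]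
  have hcyc : IsCompactCycle
      (fun a => onPaths ψ.pos ψ.isAsympHom_pos.continuous (affinePath (s₀ a) (s₁ a)))
      (fun a => onPaths ψ.neg ψ.isAsympHom_neg.continuous (affinePath (s₀ a) (s₁ a))) := by
    refine isCompactCycle_comp (J := {f | ∀ τ, X.p (f τ) = 0}) ψ.isAsympHom_pos.onPaths
      ψ.isAsympHom_neg.onPaths (fun f hf g τ => ?_) (fun f hf => ?_)
      (continuous_affinePath h₀.continuous h₁.continuous) (fun z a => ?_) (fun a τ => ?_)
      (fun a => ?_) (fun a b τ => ?_) (fun a b τ => ?_)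
    · rw [ContinuousMap.mul_apply, map_mul, hf τ, zero_mul]
    · ext t τ
      exact congrArg (fun g : Cb B => g t) (ψ.agree _ (hf τ))
    · rw [h₀.map_smul, h₁.map_smul, affinePath_smul]
    · simp [hp, StarHomClass.map_star]
    · refine vanishes_swap fun τ => ?_
      have h : (affinePath (s₀ (star a)) (s₁ (star a)) - star (affinePath (s₀ a) (s₁ a))) τ =
          (1 - (τ : ℝ) : ℂ) • (s₀ (star a) - star (s₀ a)) +
            ((τ : ℝ) : ℂ) • (s₁ (star a) - star (s₁ a)) := by
        simp only [ContinuousMap.sub_apply, ContinuousMap.star_apply, affinePath_apply, star_add,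
          star_smul, smul_sub]
        simp
        abel
      have hψ := ψ.isAsympHom_pos
      rw [ContinuousMap.comp_apply, h]
      refine ((hψ.map_add ((1 - (τ : ℝ) : ℂ) • (s₀ (star a) - star (s₀ a)))
        (((τ : ℝ) : ℂ) • (s₁ (star a) - star (s₁ a)))).add
        (((h₀.map_star a).smul (1 - (τ : ℝ) : ℂ)).add
        ((h₁.map_star a).smul ((τ : ℝ) : ℂ)))).congr ?_
      rw [← hψ.map_smul, ← hψ.map_smul]
      convert vanishes_zero using 1
      simp only [ContinuousMap.coe_mk]
      abel
    · simp [hp]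
    · simp [hp]
  refine ⟨⟨_, _, hcyc⟩, fun a t => ?_⟩
  simp [cycle]

end Restriction

/-! ### Mapping cylinders in the direct limit -/

section Extensions

variable {A : Type u} [NonUnitalCStarAlgebra A] {B : Type v} [NonUnitalCStarAlgebra B]

/-- The object of `𝓔_A` given by a separable closed `*`-subalgebra of a `C*`-algebra `D` and a
`*`-homomorphism `D → A` that maps it onto `A`. -/
noncomputable def SepExt.ofSubalgebra {D : Type w} [NonUnitalCStarAlgebra D]
    (K : NonUnitalStarSubalgebra ℂ D) (hcl : IsClosed (K : Set D))
    (hsep : TopologicalSpace.IsSeparable (K : Set D)) (p : D →⋆ₙₐ[ℂ] A)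
    (hp : ∀ a, ∃ d ∈ K, p d = a) : SepExt.{u, w} A where
  C := K
  cstar := haveI := hcl; NonUnitalStarSubalgebra.nonUnitalCStarAlgebra K
  separable := hsep.separableSpace
  p := p.comp (NonUnitalStarSubalgebraClass.subtype K)
  surjective a := by
    obtain ⟨d, hd, h⟩ := hp a
    exact ⟨⟨d, hd⟩, h⟩

theorem EN.mk_pullback {X Y : SepExt.{u, max u v} A} (κ : SepExt.Hom Y X) (ψ : Pair X B) :
    EN.mk Y (ψ.pullback κ) = EN.mk X ψ :=
  (Quot.sound ⟨κ, rfl⟩ : EN.mk X ψ = EN.mk Y (ψ.pullback κ)).symm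

theorem EN.mk_eq_of_homotopic {X : SepExt.{u, max u v} A} {ψ φ : Pair X B}
    (h : Pair.Homotopic ψ φ) : EN.mk X ψ = EN.mk X φ :=
  congrArg (fun x => (Quot.mk _ ⟨X, x⟩ : EN A B)) (Quot.sound h)

/-- The composition of a pair on `C` with a `*`-homomorphism `C' → C` over `A`, not necessarily
surjective. -/
def Pair.comp {X Y : SepExt.{u, w} A} (ψ : Pair X B) (f : Y.C →⋆ₙₐ[ℂ] X.C)
    (hf : ∀ c, X.p (f c) = Y.p c) : Pair Y B where
  pos c := ψ.pos (f c)
  neg c := ψ.neg (f c)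
  isAsympHom_pos := ψ.isAsympHom_pos.comp_starHom f
  isAsympHom_neg := ψ.isAsympHom_neg.comp_starHom f
  agree c hc := ψ.agree _ (by rw [hf, hc])

section MappingCylinder

variable {X Y : SepExt.{u, w} A} (f : Y.C →⋆ₙₐ[ℂ] X.C)

/-- The pairs `(y, h)` of an element of `C'` and a path `h` in `C` from `f y` that is constant
over `A`. -/
noncomputable def cylinderAlg : NonUnitalStarSubalgebra ℂ (Y.C × C(unitInterval, X.C)) where
  carrier := {q | q.2 0 = f q.1 ∧ ∀ τ, X.p (q.2 τ) = Y.p q.1}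
  add_mem' := fun {q r} hq hr => ⟨by simp [hq.1, hr.1], fun τ => by simp [hq.2 τ, hr.2 τ]⟩
  zero_mem' := ⟨by simp, fun τ => by simp⟩
  smul_mem' z q hq := ⟨by simp [hq.1], fun τ => by simp [hq.2 τ]⟩
  mul_mem' := fun {q r} hq hr => ⟨by simp [hq.1, hr.1], fun τ => by simp [hq.2 τ, hr.2 τ]⟩
  star_mem' := fun {q} hq =>
    ⟨by simp [hq.1, map_star], fun τ => by simp [hq.2 τ, map_star]⟩

theorem isClosed_cylinderAlg : IsClosed (cylinderAlg f : Set (Y.C × C(unitInterval, X.C))) := by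
  have hτ : ∀ τ : unitInterval, Continuous fun q : Y.C × C(unitInterval, X.C) => q.2 τ :=
    fun τ => (continuous_eval_const τ).comp continuous_snd
  have h1 : IsClosed {q : Y.C × C(unitInterval, X.C) | q.2 0 = f q.1} :=
    isClosed_eq (hτ 0) ((map_continuous f).comp continuous_fst)
  have h2 : IsClosed {q : Y.C × C(unitInterval, X.C) | ∀ τ, X.p (q.2 τ) = Y.p q.1} := by
    rw [Set.ofPred_forall]
    exact isClosed_iInter fun τ => isClosed_eq ((map_continuous X.p).comp (hτ τ))
      ((map_continuous Y.p).comp continuous_fst)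
  exact h1.inter h2

variable (hf : ∀ c, X.p (f c) = Y.p c)

/-- The mapping cylinder of a `*`-homomorphism `C' → C` over `A`, as an object of `𝓔_A`. -/
noncomputable def SepExt.cylinder : SepExt.{u, w} A :=
  SepExt.ofSubalgebra (cylinderAlg f) (isClosed_cylinderAlg f)
    (by
      have := UniformSpace.secondCountable_of_separable X.C
      have := UniformSpace.secondCountable_of_separable Y.C
      exact TopologicalSpace.IsSeparable.of_separableSpace _)
    (Y.p.comp (NonUnitalStarAlgHom.fst ℂ Y.C C(unitInterval, X.C)))
    (fun a => by
      obtain ⟨y, rfl⟩ := Y.surjective a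
      exact ⟨(y, ContinuousMap.const _ (f y)), ⟨rfl, fun _ => hf y⟩, rfl⟩)

/-- The projection of the mapping cylinder onto its bottom. -/
noncomputable def SepExt.cylinderBot : SepExt.Hom (SepExt.cylinder f hf) Y where
  toHom := (NonUnitalStarAlgHom.fst ℂ Y.C C(unitInterval, X.C)).comp
    (NonUnitalStarSubalgebraClass.subtype (cylinderAlg f))
  surjective y := ⟨⟨(y, ContinuousMap.const _ (f y)), ⟨rfl, fun _ => hf y⟩⟩, rfl⟩
  comm _ := rfl

/-- The evaluation of paths at `τ`, as a `*`-homomorphism. -/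
noncomputable def pathEval (D : Type w) [NonUnitalCStarAlgebra D] (τ : unitInterval) :
    C(unitInterval, D) →⋆ₙₐ[ℂ] D where
  toFun h := h τ
  map_smul' _ _ := rfl
  map_zero' := rfl
  map_add' _ _ := rfl
  map_mul' _ _ := rfl
  map_star' _ := rfl

/-- The end point map of the mapping cylinder. It is surjective because a point of `C` can be
joined by an affine path with a point of the image of `f` over the same element of `A`. -/
noncomputable def SepExt.cylinderTop : SepExt.Hom (SepExt.cylinder f hf) X where
  toHom := ((pathEval X.C 1).comp (NonUnitalStarAlgHom.snd ℂ Y.C C(unitInterval, X.C))).comp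
    (NonUnitalStarSubalgebraClass.subtype (cylinderAlg f))
  surjective x := by
    obtain ⟨y, hy⟩ := Y.surjective (X.p x)
    refine ⟨⟨(y, affinePath (f y) x), affinePath_zero _ _, fun τ => ?_⟩, affinePath_one (f y) x⟩
    rw [affinePath_apply, map_add, map_smul, map_smul, hf, hy, ← add_smul, sub_add_cancel, one_smul]
  comm c := c.2.2 1

/-- In the direct limit a pair may be pulled back along any `*`-homomorphism over `A`: the mapping
cylinder maps onto both algebras, and its paths are a homotopy between the two pull-backs. -/
theorem EN.mk_comp {X Y : SepExt.{u, max u v} A} (ψ : Pair X B) (f : Y.C →⋆ₙₐ[ℂ] X.C)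
    (hf : ∀ c, X.p (f c) = Y.p c) : EN.mk Y (ψ.comp f hf) = EN.mk X ψ := by
  rw [← EN.mk_pullback (SepExt.cylinderBot f hf), ← EN.mk_pullback (SepExt.cylinderTop f hf) ψ]
  refine EN.mk_eq_of_homotopic ?_
  let P : SepExt.{u, max u v} A := SepExt.cylinder f hf
  let r : P.C →⋆ₙₐ[ℂ] C(unitInterval, X.C) :=
    (NonUnitalStarAlgHom.snd ℂ Y.C C(unitInterval, X.C)).comp
      (NonUnitalStarSubalgebraClass.subtype (cylinderAlg f))
  refine ⟨⟨_, _, ψ.isAsympHom_pos.onPaths.comp_starHom r,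
    ψ.isAsympHom_neg.onPaths.comp_starHom r, fun c hc => ?_⟩, fun c t => ?_⟩
  · ext t τ
    exact congrArg (fun g : Cb B => g t) (ψ.agree _ ((c.2.2 τ).trans hc))
  · have h0 : r c 0 = f c.1.1 := c.2.1
    refine ⟨?_, ?_, rfl, rfl⟩
    · exact congrArg (fun x => ψ.pos x t) h0
    · exact congrArg (fun x => ψ.neg x t) h0

end MappingCylinder

end Extensions

/-! ### From compact cycles to pairs of asymptotic homomorphisms -/

section Separability

open TopologicalSpace

theorem isSeparable_subsemigroupClosure {M : Type*} [Semigroup M] [TopologicalSpace M]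
    [ContinuousMul M] {s : Set M} (hs : IsSeparable s) :
    IsSeparable (Subsemigroup.closure s : Set M) := by
  -- `T n` contains the products of at most `2 ^ n` factors in `s`.
  let T : ℕ → Set M := fun n => n.rec s fun _ t => t ∪ (fun q : M × M => q.1 * q.2) '' t ×ˢ t
  have hT : ∀ n, IsSeparable (T n) := by
    intro n
    induction n with
    | zero => exact hs
    | succ n ih => exact ih.union ((ih.prod ih).image continuous_mul)
  have hmono : Monotone T := monotone_nat_of_le_succ fun n => Set.subset_union_left
  let S : Subsemigroup M :=
    { carrier := ⋃ n, T n
      mul_mem' := by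
        intro a b ha hb
        obtain ⟨m, hm⟩ := Set.mem_iUnion.1 ha
        obtain ⟨n, hn⟩ := Set.mem_iUnion.1 hb
        exact Set.mem_iUnion.2 ⟨max m n + 1, Or.inr ⟨(a, b),
          ⟨hmono (le_max_left m n) hm, hmono (le_max_right m n) hn⟩, rfl⟩⟩ }
  exact (IsSeparable.iUnion hT).mono
    (Subsemigroup.closure_le (S := S).2 (Set.subset_iUnion T 0))

theorem isSeparable_adjoin {D : Type*} [NonUnitalCStarAlgebra D] {s : Set D}
    (hs : IsSeparable s) : IsSeparable (NonUnitalStarAlgebra.adjoin ℂ s : Set D) := by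
  have h : IsSeparable (s ∪ star s) := by
    refine hs.union ?_
    rw [← Set.image_star]
    exact hs.image continuous_star
  have h' := (isSeparable_subsemigroupClosure h).span (R := ℂ)
  rwa [← NonUnitalStarAlgebra.adjoin_eq_span] at h'

end Separability

section Annihilator

variable {A : Type u} {B : Type v} [NonUnitalCStarAlgebra B] {Φp Φm : A → Cb B}

theorem pos_mem_algE (a : A) : Φp a ∈ algE Φp Φm :=
  NonUnitalStarSubalgebra.le_topologicalClosure _
    (NonUnitalStarAlgebra.subset_adjoin ℂ _ (Or.inl ⟨a, rfl⟩))

theorem neg_mem_algE (a : A) : Φm a ∈ algE Φp Φm :=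
  NonUnitalStarSubalgebra.le_topologicalClosure _
    (NonUnitalStarAlgebra.subset_adjoin ℂ _ (Or.inr ⟨a, rfl⟩))

theorem isClosed_algE : IsClosed (algE Φp Φm : Set (Cb B)) :=
  NonUnitalStarSubalgebra.isClosed_topologicalClosure _

variable (Φp Φm) in
/-- The ideal of those elements of `E` that annihilate `D` modulo `C_0(ℝ₊; B)`. It contains the
defects of a compact asymptotic `KK`-cycle from additivity and multiplicativity. -/
noncomputable def annihilator : Submodule ℂ (Cb B) where
  carrier := {n | n ∈ algE Φp Φm ∧ ∀ x ∈ idealD Φp Φm, Vanishes (n * x)}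
  add_mem' hm hn := ⟨(algE Φp Φm).add_mem hm.1 hn.1, fun x hx => by
    rw [add_mul]; exact (hm.2 x hx).add (hn.2 x hx)⟩
  zero_mem' := ⟨(algE Φp Φm).zero_mem, fun x _ => by rw [zero_mul]; exact vanishes_zero⟩
  smul_mem' z n hn := ⟨SMulMemClass.smul_mem z hn.1, fun x hx => by
    rw [smul_mul_assoc]; exact (hn.2 x hx).smul z⟩

theorem mem_annihilator {n : Cb B} : n ∈ annihilator Φp Φm ↔
    n ∈ algE Φp Φm ∧ ∀ x ∈ idealD Φp Φm, Vanishes (n * x) := Iff.rfl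

theorem isClosed_annihilator : IsClosed (annihilator Φp Φm : Set (Cb B)) := by
  have h : (annihilator Φp Φm : Set (Cb B)) = (algE Φp Φm : Set (Cb B)) ∩
      ⋂ x ∈ idealD Φp Φm, {n | Vanishes (n * x)} := by
    ext n
    simp [mem_annihilator]
  rw [h]
  exact isClosed_algE.inter (isClosed_biInter fun x _ =>
    isClosed_vanishes.preimage (continuous_id.mul continuous_const))

theorem mul_mem_annihilator {e n : Cb B} (he : e ∈ algE Φp Φm) (hn : n ∈ annihilator Φp Φm) :
    e * n ∈ annihilator Φp Φm :=
  ⟨(algE Φp Φm).mul_mem he hn.1, fun x hx => by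
    rw [mul_assoc]; exact (hn.2 x hx).mul_left e⟩

theorem mul_mem_annihilator_right {e n : Cb B} (he : e ∈ algE Φp Φm)
    (hn : n ∈ annihilator Φp Φm) : n * e ∈ annihilator Φp Φm :=
  ⟨(algE Φp Φm).mul_mem hn.1 he, fun x hx => by
    rw [mul_assoc]; exact hn.2 _ ((idealD_spec Φp Φm).2 e he x hx).1⟩

theorem star_mem_annihilator {n : Cb B} (hn : n ∈ annihilator Φp Φm) :
    star n ∈ annihilator Φp Φm :=
  ⟨star_mem hn.1, fun x hx => vanishes_of_star_mul_self (by
    -- `n* x` is again in `D`, so that `n (n* x)` vanishes at infinity.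
    rw [star_mul, star_star, mul_assoc]
    exact (hn.2 _ ((idealD_spec Φp Φm).2 _ (star_mem hn.1) x hx).1).mul_left _)⟩

theorem Vanishes.mem_annihilator {n : Cb B} (hn : Vanishes n) (he : n ∈ algE Φp Φm) :
    n ∈ annihilator Φp Φm :=
  ⟨he, fun x _ => hn.mul_right x⟩

variable [NonUnitalCStarAlgebra A]

/-- The annihilator also annihilates `D*`, although `D` is self-adjoint only modulo
`C_0(ℝ₊; B)` by its definition. -/
theorem IsCompactCycle.vanishes_mul_star (h : IsCompactCycle Φp Φm) {n x : Cb B}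
    (hn : n ∈ annihilator Φp Φm) (hx : x ∈ idealD Φp Φm) : Vanishes (n * star x) := by
  let S : Submodule ℂ (Cb B) :=
    { carrier := {x | ∀ n ∈ annihilator Φp Φm, Vanishes (n * star x)}
      add_mem' := fun hx hy n hn => by
        rw [star_add, mul_add]; exact (hx n hn).add (hy n hn)
      zero_mem' := fun n _ => by rw [star_zero, mul_zero]; exact vanishes_zero
      smul_mem' := fun z x hx n hn => by
        rw [star_smul, mul_smul_comm]; exact (hx n hn).smul _ }
  refine (Submodule.mem_sInf).1 hx S ⟨?_, fun a n hn => ?_, fun e he x hx => ⟨fun n hn => ?_,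
    fun n hn => ?_⟩⟩ n hn
  · have hS : (S : Set (Cb B)) = ⋂ n ∈ annihilator Φp Φm, {x | Vanishes (n * star x)} := by
      ext; simp [S]
    rw [hS]
    exact isClosed_biInter fun n _ =>
      isClosed_vanishes.preimage (continuous_const.mul continuous_star)
  · have : n * star (Φp a - Φm a) = n * (Φp (star a) - Φm (star a)) -
        n * ((Φp (star a) - star (Φp a)) - (Φm (star a) - star (Φm a))) := by
      rw [star_sub]; noncomm_ring
    rw [this]
    exact (hn.2 _ ((idealD_spec Φp Φm).1 _)).sub
      (((h.star_pos a).sub (h.star_neg a)).mul_left n)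
  · rw [star_mul, ← mul_assoc]
    exact (hx n hn).mul_right _
  · rw [star_mul, ← mul_assoc]
    exact hx _ (mul_mem_annihilator_right (star_mem he) hn)

theorem IsCompactCycle.vanishes_mul_annihilator (h : IsCompactCycle Φp Φm) {n x : Cb B}
    (hn : n ∈ annihilator Φp Φm) (hx : x ∈ idealD Φp Φm) : Vanishes (x * n) := by
  simpa using (h.vanishes_mul_star (star_mem_annihilator hn) hx).star

/-- An ideal and its annihilator meet in zero. -/
theorem IsCompactCycle.vanishes_of_mem (h : IsCompactCycle Φp Φm) {n : Cb B}
    (hn : n ∈ annihilator Φp Φm) (hx : n ∈ idealD Φp Φm) : Vanishes n := by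
  have h1 : Vanishes (star (star n) * star n) := by
    rw [star_star]; exact h.vanishes_mul_star hn hx
  simpa using (vanishes_of_star_mul_self h1).star

theorem IsCompactCycle.add_pos_mem (h : IsCompactCycle Φp Φm) (a b : A) :
    Φp (a + b) - Φp a - Φp b ∈ annihilator Φp Φm :=
  ⟨sub_mem (sub_mem (pos_mem_algE _) (pos_mem_algE _)) (pos_mem_algE _), h.add_pos a b⟩

theorem IsCompactCycle.add_neg_mem (h : IsCompactCycle Φp Φm) (a b : A) :
    Φm (a + b) - Φm a - Φm b ∈ annihilator Φp Φm :=
  ⟨sub_mem (sub_mem (neg_mem_algE _) (neg_mem_algE _)) (neg_mem_algE _), h.add_neg a b⟩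

theorem IsCompactCycle.mul_pos_mem (h : IsCompactCycle Φp Φm) (a b : A) :
    Φp (a * b) - Φp a * Φp b ∈ annihilator Φp Φm :=
  ⟨sub_mem (pos_mem_algE _) (mul_mem (pos_mem_algE _) (pos_mem_algE _)), h.mul_pos a b⟩

theorem IsCompactCycle.mul_neg_mem (h : IsCompactCycle Φp Φm) (a b : A) :
    Φm (a * b) - Φm a * Φm b ∈ annihilator Φp Φm :=
  ⟨sub_mem (neg_mem_algE _) (mul_mem (neg_mem_algE _) (neg_mem_algE _)), h.mul_neg a b⟩

/-- `Φ⁺` and `Φ⁻` have asymptotically the same defect from additivity: the difference of the two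
defects lies in `D` and in its annihilator. -/
theorem IsCompactCycle.vanishes_add_sub (h : IsCompactCycle Φp Φm) (a b : A) :
    Vanishes ((Φp (a + b) - Φp a - Φp b) - (Φm (a + b) - Φm a - Φm b)) := by
  refine h.vanishes_of_mem (sub_mem (h.add_pos_mem a b) (h.add_neg_mem a b)) ?_
  have hD := (idealD_spec Φp Φm).1
  have : (Φp (a + b) - Φp a - Φp b) - (Φm (a + b) - Φm a - Φm b) =
      (Φp (a + b) - Φm (a + b)) - (Φp a - Φm a) - (Φp b - Φm b) := by abel
  rw [this]
  exact sub_mem (sub_mem (hD _) (hD _)) (hD _)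

/-- `Φ⁺` and `Φ⁻` have asymptotically the same defect from multiplicativity. -/
theorem IsCompactCycle.vanishes_mul_sub (h : IsCompactCycle Φp Φm) (a b : A) :
    Vanishes ((Φp (a * b) - Φp a * Φp b) - (Φm (a * b) - Φm a * Φm b)) := by
  refine h.vanishes_of_mem (sub_mem (h.mul_pos_mem a b) (h.mul_neg_mem a b)) ?_
  have hD := idealD_spec Φp Φm
  have : (Φp (a * b) - Φp a * Φp b) - (Φm (a * b) - Φm a * Φm b) =
      (Φp (a * b) - Φm (a * b)) - (Φp a - Φm a) * Φp b - Φm a * (Φp b - Φm b) := by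
    noncomm_ring
  rw [this]
  exact sub_mem (sub_mem (hD.1 _) (hD.2 _ (pos_mem_algE b) _ (hD.1 a)).2)
    (hD.2 _ (neg_mem_algE a) _ (hD.1 b)).1

end Annihilator

section CycleExtension

variable {A : Type u} [NonUnitalCStarAlgebra A] {B : Type v} [NonUnitalCStarAlgebra B]

/-- The pairs `(a, e)` for which `e - Φ⁺(a)` annihilates `D` asymptotically. -/
noncomputable def CompactCycle.hull (Φ : CompactCycle A B) :
    NonUnitalStarSubalgebra ℂ (A × Cb B) where
  carrier := {q | q.2 - Φ.pos q.1 ∈ annihilator Φ.pos Φ.neg}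
  add_mem' := fun {q r} hq hr => by
    have : (q + r).2 - Φ.pos (q + r).1 = (q.2 - Φ.pos q.1) + (r.2 - Φ.pos r.1) -
        (Φ.pos (q.1 + r.1) - Φ.pos q.1 - Φ.pos r.1) := by
      simp only [Prod.fst_add, Prod.snd_add]; abel
    rw [Set.mem_ofPred_eq, this]
    exact sub_mem (add_mem hq hr) (Φ.isCycle.add_pos_mem _ _)
  zero_mem' := by
    have h := Φ.isCycle.smul_pos 0 0
    rw [zero_smul, zero_smul] at h
    simp [h]
  smul_mem' z q hq := by
    rw [Set.mem_ofPred_eq, Prod.smul_fst, Prod.smul_snd, Φ.isCycle.smul_pos, ← smul_sub]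
    exact Submodule.smul_mem _ z hq
  mul_mem' := fun {q r} hq hr => by
    have hqE : q.2 ∈ algE Φ.pos Φ.neg := by
      have := add_mem hq.1 (pos_mem_algE (Φm := Φ.neg) q.1)
      rwa [sub_add_cancel] at this
    have : (q * r).2 - Φ.pos (q * r).1 = q.2 * (r.2 - Φ.pos r.1) +
        (q.2 - Φ.pos q.1) * Φ.pos r.1 -
        (Φ.pos (q.1 * r.1) - Φ.pos q.1 * Φ.pos r.1) := by
      simp only [Prod.fst_mul, Prod.snd_mul]; noncomm_ring
    rw [Set.mem_ofPred_eq, this]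
    exact sub_mem (add_mem (mul_mem_annihilator hqE hr)
      (mul_mem_annihilator_right (pos_mem_algE _) hq)) (Φ.isCycle.mul_pos_mem _ _)
  star_mem' := fun {q} hq => by
    have : (star q).2 - Φ.pos (star q).1 = star (q.2 - Φ.pos q.1) -
        (Φ.pos (star q.1) - star (Φ.pos q.1)) := by
      simp only [Prod.fst_star, Prod.snd_star, star_sub]; abel
    rw [Set.mem_ofPred_eq, this]
    exact sub_mem (star_mem_annihilator hq) ((Φ.isCycle.star_pos _).mem_annihilator
      (sub_mem (pos_mem_algE _) (star_mem (pos_mem_algE _))))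

theorem CompactCycle.isClosed_hull (Φ : CompactCycle A B) :
    IsClosed (Φ.hull : Set (A × Cb B)) :=
  isClosed_annihilator.preimage
    (continuous_snd.sub (Φ.isCycle.continuous_pos.comp continuous_fst))

/-- The `C*`-subalgebra of `A × C_b(ℝ₊; B)` generated by the graph of `Φ⁺`. -/
noncomputable def CompactCycle.graphAlg (Φ : CompactCycle A B) :
    NonUnitalStarSubalgebra ℂ (A × Cb B) :=
  (NonUnitalStarAlgebra.adjoin ℂ (Set.range fun a => (a, Φ.pos a))).topologicalClosure

theorem CompactCycle.mem_graphAlg (Φ : CompactCycle A B) (a : A) :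
    (a, Φ.pos a) ∈ Φ.graphAlg :=
  NonUnitalStarSubalgebra.le_topologicalClosure _
    (NonUnitalStarAlgebra.subset_adjoin ℂ _ ⟨a, rfl⟩)

theorem CompactCycle.graphAlg_le_hull (Φ : CompactCycle A B) : Φ.graphAlg ≤ Φ.hull := by
  refine NonUnitalStarSubalgebra.topologicalClosure_minimal _
    (NonUnitalStarAlgebra.adjoin_le ?_) Φ.isClosed_hull
  rintro _ ⟨a, rfl⟩
  change Φ.pos a - Φ.pos a ∈ annihilator Φ.pos Φ.neg
  rw [sub_self]
  exact Submodule.zero_mem _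

variable [TopologicalSpace.SeparableSpace A]

/-- The object of `𝓔_A` generated by the graph of `Φ⁺`. -/
noncomputable def CompactCycle.graphExt (Φ : CompactCycle A B) : SepExt.{u, max u v} A :=
  SepExt.ofSubalgebra Φ.graphAlg (NonUnitalStarSubalgebra.isClosed_topologicalClosure _)
    (isSeparable_adjoin (TopologicalSpace.isSeparable_range
      (continuous_id.prodMk Φ.isCycle.continuous_pos))).closure
    (NonUnitalStarAlgHom.fst ℂ A (Cb B)) fun a => ⟨_, Φ.mem_graphAlg a, rfl⟩

/-- The inclusion of the algebra generated by the graph of `Φ⁺` into `A × C_b(ℝ₊; B)`. -/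
noncomputable def CompactCycle.incl (Φ : CompactCycle A B) : Φ.graphExt.C →⋆ₙₐ[ℂ] A × Cb B :=
  NonUnitalStarSubalgebraClass.subtype Φ.graphAlg

theorem CompactCycle.continuous_incl (Φ : CompactCycle A B) : Continuous Φ.incl :=
  continuous_subtype_val

theorem CompactCycle.incl_mem (Φ : CompactCycle A B) (c : Φ.graphExt.C) :
    Φ.incl c ∈ Φ.graphAlg := c.2

theorem CompactCycle.p_eq (Φ : CompactCycle A B) (c : Φ.graphExt.C) :
    Φ.graphExt.p c = (Φ.incl c).1 := rfl

/-- The pair `ψ⁺(a, e) = e`, `ψ⁻(a, e) = e - Φ⁺(a) + Φ⁻(a)` on the algebra generated by the graph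
of `Φ⁺`. Here `ψ⁺` is a `*`-homomorphism, `ψ⁻` takes the graph of `Φ⁺` to `Φ⁻`, and the two agree
where `a = 0`. -/
noncomputable def CompactCycle.toPair (Φ : CompactCycle A B) : Pair Φ.graphExt B where
  pos c := (Φ.incl c).2
  neg c := (Φ.incl c).2 - Φ.pos (Φ.incl c).1 + Φ.neg (Φ.incl c).1
  isAsympHom_pos :=
    { continuous := continuous_snd.comp Φ.continuous_incl
      map_smul := fun z c => by rw [map_smul, Prod.smul_snd]
      map_star := fun c => by
        rw [map_star, Prod.snd_star, sub_self]; exact vanishes_zero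
      map_add := fun c d => by
        rw [map_add, Prod.snd_add, add_sub_cancel_left, sub_self]; exact vanishes_zero
      map_mul := fun c d => by
        rw [map_mul, Prod.snd_mul, sub_self]; exact vanishes_zero }
  isAsympHom_neg :=
    { continuous := ((continuous_snd.comp Φ.continuous_incl).sub
        (Φ.isCycle.continuous_pos.comp (continuous_fst.comp Φ.continuous_incl))).add
        (Φ.isCycle.continuous_neg.comp (continuous_fst.comp Φ.continuous_incl))
      map_smul := fun z c => by
        rw [map_smul, Prod.smul_snd, Prod.smul_fst, Φ.isCycle.smul_pos, Φ.isCycle.smul_neg,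
          smul_add, smul_sub]
      map_star := fun c => by
        rw [map_star, Prod.snd_star, Prod.fst_star]
        refine ((Φ.isCycle.star_neg (Φ.incl c).1).sub
          (Φ.isCycle.star_pos (Φ.incl c).1)).congr ?_
        rw [star_add, star_sub]
        convert vanishes_zero using 1
        abel
      map_add := fun c d => by
        rw [map_add, Prod.snd_add, Prod.fst_add]
        refine (Φ.isCycle.vanishes_add_sub (Φ.incl c).1 (Φ.incl d).1).neg.congr ?_
        convert vanishes_zero using 1
        abel
      map_mul := fun c d => by
        rw [map_mul, Prod.snd_mul, Prod.fst_mul]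
        -- With `δ = Φ⁺ - Φ⁻`, `n = e - Φ⁺(a)` and `n' = e' - Φ⁺(a')` the defect is
        -- `n δ(a') + δ(a) n'` minus the difference of the defects of `Φ⁺` and `Φ⁻`.
        generalize hq : Φ.incl c = q
        generalize hr : Φ.incl d = r
        have hqn : q.2 - Φ.pos q.1 ∈ annihilator Φ.pos Φ.neg := by
          rw [← hq]; exact Φ.graphAlg_le_hull (Φ.incl_mem c)
        have hrn : r.2 - Φ.pos r.1 ∈ annihilator Φ.pos Φ.neg := by
          rw [← hr]; exact Φ.graphAlg_le_hull (Φ.incl_mem d)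
        have hD := (idealD_spec Φ.pos Φ.neg).1
        have h1 := hqn.2 _ (hD r.1)
        have h2 := Φ.isCycle.vanishes_mul_annihilator hrn (hD q.1)
        have h3 := Φ.isCycle.vanishes_mul_sub q.1 r.1
        refine ((h1.add h2).sub h3).congr ?_
        convert vanishes_zero using 1
        noncomm_ring }
  agree c hc := by
    rw [Φ.p_eq] at hc
    have hp := Φ.isCycle.smul_pos 0 0
    have hm := Φ.isCycle.smul_neg 0 0
    rw [zero_smul, zero_smul] at hp hm
    rw [hc, hp, hm, sub_zero, add_zero]

end CycleExtension

/-! ### The map `γ` and its inverse -/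

section Gamma

variable {A : Type u} [NonUnitalCStarAlgebra A] {B : Type v} [NonUnitalCStarAlgebra B]

theorem SepExt.IsSection.comp_hom {X Y : SepExt.{u, w} A} {s : A → Y.C} (hs : Y.IsSection s)
    (κ : SepExt.Hom Y X) : X.IsSection fun a => κ.toHom (s a) where
  continuous := (map_continuous κ.toHom).comp hs.continuous
  map_smul z a := by rw [hs.map_smul, _root_.map_smul]
  map_star a := by rw [hs.map_star, StarHomClass.map_star]
  right_inv a := by rw [κ.comm, hs.right_inv]

theorem EM.mk_cycle_eq {X : SepExt.{u, w} A} {ψ : Pair X B} {s₀ s₁ : A → X.C}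
    (h₀ : ψ.IsQuasiSection s₀) (h₁ : ψ.IsQuasiSection s₁) :
    EM.mk h₀.cycle = EM.mk h₁.cycle :=
  Quot.sound (h₀.homotopic h₁)

/-- The class of the cycle `(ψ⁺ ∘ s, ψ⁻ ∘ s)`, for some section `s`. -/
noncomputable def Pair.restrict {X : SepExt.{u, w} A} (ψ : Pair X B) : EM A B :=
  EM.mk (X.exists_isSection.choose_spec.isQuasiSection ψ).cycle

theorem Pair.restrict_eq {X : SepExt.{u, w} A} {ψ : Pair X B} {s : A → X.C}
    (hs : ψ.IsQuasiSection s) : ψ.restrict = EM.mk hs.cycle :=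
  EM.mk_cycle_eq _ hs

/-- Composition with a section, on homotopy classes of pairs. -/
noncomputable def ENJ.restrict {X : SepExt.{u, w} A} : ENJ X B → EM A B :=
  Quot.lift Pair.restrict fun _ _ ⟨φ, h⟩ => by
    have hs := X.exists_isSection.choose_spec
    exact Quot.sound ⟨(hs.isQuasiSection φ).cycle, fun a t => h _ t⟩

variable (A B) in
/-- The map `γ : EN(A, B) → EM(A, B)`. -/
noncomputable def gamma : EN A B → EM A B :=
  Quot.lift (fun x => ENJ.restrict x.2) (by
    rintro ⟨X, x⟩ ⟨Y, y⟩ ⟨κ, h⟩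
    dsimp only at κ h
    subst h
    induction x using Quot.ind with
    | mk ψ =>
      obtain ⟨s, hs⟩ := Y.exists_isSection
      exact (Pair.restrict_eq ((hs.comp_hom κ).isQuasiSection ψ)).trans
        (Pair.restrict_eq (hs.isQuasiSection (ψ.pullback κ))).symm)

theorem gamma_mk {X : SepExt.{u, max u v} A} {ψ : Pair X B} {s : A → X.C}
    (hs : ψ.IsQuasiSection s) : gamma A B (EN.mk X ψ) = EM.mk hs.cycle :=
  Pair.restrict_eq hs

theorem isGamma_gamma : IsGamma (gamma A B) := fun _ ψ _ hs =>
  ⟨(hs.isQuasiSection ψ).isCompactCycle, gamma_mk (hs.isQuasiSection ψ)⟩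

theorem EN.exists_mk (x : EN A B) : ∃ (X : SepExt.{u, max u v} A) (ψ : Pair X B),
    EN.mk X ψ = x := by
  induction x using Quot.ind with
  | mk x =>
    obtain ⟨X, x⟩ := x
    induction x using Quot.ind with
    | mk ψ => exact ⟨X, ψ, rfl⟩

theorem IsGamma.eq {γ γ' : EN A B → EM A B} (h : IsGamma γ) (h' : IsGamma γ') : γ' = γ := by
  funext x
  obtain ⟨X, ψ, rfl⟩ := EN.exists_mk x
  obtain ⟨s, hs⟩ := X.exists_isSection
  obtain ⟨_, h₁⟩ := h X ψ s hs
  obtain ⟨_, h₂⟩ := h' X ψ s hs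
  rw [h₁, h₂]

theorem gamma_add (S : IsometryPair B) (x y : EN A B) :
    gamma A B (EN.add S x y) = EM.add S (gamma A B x) (gamma A B y) := by
  obtain ⟨X, ψ, rfl⟩ := EN.exists_mk x
  obtain ⟨Y, φ, rfl⟩ := EN.exists_mk y
  obtain ⟨s, hs⟩ := (X.pull Y).exists_isSection
  rw [gamma_mk ((hs.comp_hom (X.fst Y)).isQuasiSection ψ),
    gamma_mk ((hs.comp_hom (X.snd Y)).isQuasiSection φ)]
  exact gamma_mk (hs.isQuasiSection
    (Pair.add S (ψ.pullback (X.fst Y)) (φ.pullback (X.snd Y))))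

end Gamma

section Inverse

variable {A : Type u} [NonUnitalCStarAlgebra A] {B : Type v} [NonUnitalCStarAlgebra B]

theorem IsAsympHom.evalAt {φ : A → Cb (IB B)} (hφ : IsAsympHom φ) (τ : unitInterval) :
    IsAsympHom fun a => evalAt τ (φ a) where
  continuous := (continuous_evalAt τ).comp hφ.continuous
  map_smul z a := by rw [hφ.map_smul, _root_.map_smul]
  map_star a := (hφ.map_star a).evalAt τ
  map_add a b := (hφ.map_add a b).evalAt τ
  map_mul a b := (hφ.map_mul a b).evalAt τ

/-- The evaluation of a homotopy of pairs. -/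
noncomputable def Pair.eval {X : SepExt.{u, w} A} (ψ : Pair X (IB B)) (τ : unitInterval) :
    Pair X B where
  pos c := evalAt τ (ψ.pos c)
  neg c := evalAt τ (ψ.neg c)
  isAsympHom_pos := ψ.isAsympHom_pos.evalAt τ
  isAsympHom_neg := ψ.isAsympHom_neg.evalAt τ
  agree c hc := by rw [ψ.agree c hc]

theorem Pair.eval_homotopic {X : SepExt.{u, w} A} (ψ : Pair X (IB B)) :
    Pair.Homotopic (ψ.eval 0) (ψ.eval 1) :=
  ⟨ψ, fun _ _ => ⟨rfl, rfl, rfl, rfl⟩⟩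

variable [TopologicalSpace.SeparableSpace A]

/-- The evaluation `A × C_b(ℝ₊; IB) → A × C_b(ℝ₊; B)` maps the graph of `Ψ⁺` to the graph of `Φ⁺`,
and the pairs of the two cycles are compatible with it. -/
theorem EN.mk_toPair_eval (Ψ : CompactCycle A (IB B)) (Φ : CompactCycle A B) (τ : unitInterval)
    (hp : ∀ a, evalAt τ (Ψ.pos a) = Φ.pos a) (hm : ∀ a, evalAt τ (Ψ.neg a) = Φ.neg a) :
    EN.mk Ψ.graphExt (Ψ.toPair.eval τ) = EN.mk Φ.graphExt Φ.toPair := by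
  let M : A × Cb (IB B) →⋆ₙₐ[ℂ] A × Cb B :=
    NonUnitalStarAlgHom.prod (NonUnitalStarAlgHom.fst ℂ A (Cb (IB B)))
      ((evalAt τ).comp (NonUnitalStarAlgHom.snd ℂ A (Cb (IB B))))
  have hM : Ψ.graphAlg ≤ Φ.graphAlg.comap M := by
    refine NonUnitalStarSubalgebra.topologicalClosure_minimal _
      (NonUnitalStarAlgebra.adjoin_le ?_)
      ((NonUnitalStarSubalgebra.isClosed_topologicalClosure _).preimage
        (continuous_fst.prodMk ((continuous_evalAt τ).comp continuous_snd)))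
    rintro _ ⟨a, rfl⟩
    have : M (a, Ψ.pos a) = (a, Φ.pos a) := Prod.ext rfl (hp a)
    change M (a, Ψ.pos a) ∈ Φ.graphAlg
    rw [this]
    exact Φ.mem_graphAlg a
  let f : Ψ.graphExt.C →⋆ₙₐ[ℂ] Φ.graphExt.C :=
    NonUnitalStarAlgHom.codRestrict (M.comp Ψ.incl) Φ.graphAlg fun c => hM (Ψ.incl_mem c)
  have hf : ∀ c, Φ.graphExt.p (f c) = Ψ.graphExt.p c := fun _ => rfl
  rw [← EN.mk_comp Φ.toPair f hf]
  congr 1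
  have hneg : ∀ c, evalAt τ (Ψ.toPair.neg c) = Φ.toPair.neg (f c) := fun c => by
    change evalAt τ ((Ψ.incl c).2 - Ψ.pos (Ψ.incl c).1 + Ψ.neg (Ψ.incl c).1) =
      evalAt τ (Ψ.incl c).2 - Φ.pos (Ψ.incl c).1 + Φ.neg (Ψ.incl c).1
    rw [map_add, map_sub, hp, hm]
  simp only [Pair.eval, Pair.comp, hneg]
  rfl

variable (A B) in
/-- The inverse of `γ`: the class of the pair on the algebra generated by the graph of `Φ⁺`. -/
noncomputable def delta : EM A B → EN A B :=
  Quot.lift (fun Φ => EN.mk Φ.graphExt Φ.toPair) fun Φ₀ Φ₁ ⟨Ψ, h⟩ => by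
    rw [← EN.mk_toPair_eval Ψ Φ₀ 0 (fun a => by ext t; exact (h a t).1)
        (fun a => by ext t; exact (h a t).2.1),
      ← EN.mk_toPair_eval Ψ Φ₁ 1 (fun a => by ext t; exact (h a t).2.2.1)
        (fun a => by ext t; exact (h a t).2.2.2)]
    exact EN.mk_eq_of_homotopic Ψ.toPair.eval_homotopic

theorem delta_mk (Φ : CompactCycle A B) : delta A B (EM.mk Φ) = EN.mk Φ.graphExt Φ.toPair := rfl

/-- The graph of `Φ⁺` is a section, and the pair restricts along it to `(Φ⁺, Φ⁻)`. It respects the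
involution only asymptotically. -/
theorem gamma_delta (x : EM A B) : gamma A B (delta A B x) = x := by
  induction x using Quot.ind with
  | mk Φ =>
    have hs : Φ.toPair.IsQuasiSection
        (fun a => (⟨(a, Φ.pos a), Φ.mem_graphAlg a⟩ : Φ.graphAlg)) :=
      { continuous := (continuous_id.prodMk Φ.isCycle.continuous_pos).subtype_mk _
        map_smul := fun z a => Subtype.ext (Prod.ext rfl (Φ.isCycle.smul_pos z a))
        map_star := fun a => Φ.isCycle.star_pos a
        right_inv := fun a => rfl }
    refine (gamma_mk hs).trans (congrArg EM.mk ?_)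
    have hneg : (fun a => Φ.pos a - Φ.pos a + Φ.neg a) = Φ.neg := by
      funext a
      rw [sub_self, zero_add]
    have : ∀ (f : A → Cb B) (hf : IsCompactCycle Φ.pos f), f = Φ.neg →
        (⟨Φ.pos, f, hf⟩ : CompactCycle A B) = Φ := by
      rintro f hf rfl
      rfl
    exact this _ hs.isCompactCycle hneg

/-- For the cycle `Φ = ψ ∘ s`, the pairs `(c, d)` over the same element of `A` for which
`d = (a, e)` has `e ∼ ψ⁺(c)`. -/
noncomputable def Pair.IsQuasiSection.corrAlg {X : SepExt.{u, w} A} {ψ : Pair X B} {s : A → X.C}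
    (hs : ψ.IsQuasiSection s) : NonUnitalStarSubalgebra ℂ (X.C × hs.cycle.graphExt.C) where
  carrier := {q | X.p q.1 = hs.cycle.graphExt.p q.2 ∧
    Vanishes ((hs.cycle.incl q.2).2 - ψ.pos q.1)}
  add_mem' := fun {q r} hq hr => ⟨by simp [hq.1, hr.1], by
    rw [Prod.fst_add, Prod.snd_add, map_add, Prod.snd_add]
    refine ((hq.2.add hr.2).sub (ψ.isAsympHom_pos.map_add q.1 r.1)).congr ?_
    convert vanishes_zero using 1
    abel⟩
  zero_mem' := ⟨by simp, by
    have h := ψ.isAsympHom_pos.map_smul 0 0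
    rw [zero_smul, zero_smul] at h
    rw [Prod.fst_zero, Prod.snd_zero, map_zero, Prod.snd_zero, h, sub_zero]
    exact vanishes_zero⟩
  smul_mem' z q hq := ⟨by simp [hq.1], by
    rw [Prod.smul_fst, Prod.smul_snd, _root_.map_smul, Prod.smul_snd,
      ψ.isAsympHom_pos.map_smul, ← smul_sub]
    exact hq.2.smul z⟩
  mul_mem' := fun {q r} hq hr => ⟨by simp [hq.1, hr.1], by
    rw [Prod.fst_mul, Prod.snd_mul, map_mul, Prod.snd_mul]
    refine (((hq.2.mul_right (hs.cycle.incl r.2).2).add (hr.2.mul_left (ψ.pos q.1))).sub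
      (ψ.isAsympHom_pos.map_mul q.1 r.1)).congr ?_
    convert vanishes_zero using 1
    noncomm_ring⟩
  star_mem' := fun {q} hq => ⟨by simp [hq.1, StarHomClass.map_star], by
    rw [Prod.fst_star, Prod.snd_star, StarHomClass.map_star, Prod.snd_star]
    refine (hq.2.star.sub (ψ.isAsympHom_pos.map_star q.1)).congr ?_
    rw [star_sub]
    convert vanishes_zero using 1
    abel⟩

theorem Pair.IsQuasiSection.isClosed_corrAlg {X : SepExt.{u, w} A} {ψ : Pair X B} {s : A → X.C}
    (hs : ψ.IsQuasiSection s) : IsClosed (hs.corrAlg : Set (X.C × hs.cycle.graphExt.C)) := by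
  have h1 : IsClosed {q : X.C × hs.cycle.graphExt.C | X.p q.1 = hs.cycle.graphExt.p q.2} :=
    isClosed_eq ((map_continuous X.p).comp continuous_fst)
      ((map_continuous hs.cycle.graphExt.p).comp continuous_snd)
  exact h1.inter (isClosed_vanishes.preimage
    ((continuous_snd.comp (hs.cycle.continuous_incl.comp continuous_snd)).sub
      (ψ.isAsympHom_pos.continuous.comp continuous_fst)))

/-- The correspondence between `C` and the algebra of the cycle `ψ ∘ s`, as an object of `𝓔_A`. -/
noncomputable def Pair.IsQuasiSection.corr {X : SepExt.{u, max u v} A} {ψ : Pair X B}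
    {s : A → X.C} (hs : ψ.IsQuasiSection s) : SepExt.{u, max u v} A :=
  SepExt.ofSubalgebra hs.corrAlg hs.isClosed_corrAlg
    (by
      have := UniformSpace.secondCountable_of_separable X.C
      have := UniformSpace.secondCountable_of_separable hs.cycle.graphExt.C
      exact TopologicalSpace.IsSeparable.of_separableSpace _)
    (X.p.comp (NonUnitalStarAlgHom.fst ℂ X.C hs.cycle.graphExt.C))
    (fun a => ⟨(s a, (⟨(a, hs.cycle.pos a), hs.cycle.mem_graphAlg a⟩ : hs.cycle.graphAlg)),
      ⟨hs.right_inv a, by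
        change Vanishes (ψ.pos (s a) - ψ.pos (s a))
        rw [sub_self]
        exact vanishes_zero⟩, hs.right_inv a⟩)

/-- The projection of the correspondence to `C`. -/
noncomputable def Pair.IsQuasiSection.corrFst {X : SepExt.{u, max u v} A} {ψ : Pair X B}
    {s : A → X.C} (hs : ψ.IsQuasiSection s) : hs.corr.C →⋆ₙₐ[ℂ] X.C :=
  (NonUnitalStarAlgHom.fst ℂ X.C hs.cycle.graphExt.C).comp
    (NonUnitalStarSubalgebraClass.subtype hs.corrAlg)

/-- The projection of the correspondence to the algebra of the cycle `ψ ∘ s`. -/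
noncomputable def Pair.IsQuasiSection.corrSnd {X : SepExt.{u, max u v} A} {ψ : Pair X B}
    {s : A → X.C} (hs : ψ.IsQuasiSection s) : hs.corr.C →⋆ₙₐ[ℂ] hs.cycle.graphExt.C :=
  (NonUnitalStarAlgHom.snd ℂ X.C hs.cycle.graphExt.C).comp
    (NonUnitalStarSubalgebraClass.subtype hs.corrAlg)

theorem Pair.IsQuasiSection.p_corrFst {X : SepExt.{u, max u v} A} {ψ : Pair X B}
    {s : A → X.C} (hs : ψ.IsQuasiSection s) (c : hs.corr.C) :
    X.p (hs.corrFst c) = hs.corr.p c := rfl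

theorem Pair.IsQuasiSection.p_corrSnd {X : SepExt.{u, max u v} A} {ψ : Pair X B}
    {s : A → X.C} (hs : ψ.IsQuasiSection s) (c : hs.corr.C) :
    hs.cycle.graphExt.p (hs.corrSnd c) = hs.corr.p c :=
  (Subtype.property (p := fun q => q ∈ hs.corrAlg) c).1.symm

theorem Pair.IsQuasiSection.vanishes_corr {X : SepExt.{u, max u v} A} {ψ : Pair X B}
    {s : A → X.C} (hs : ψ.IsQuasiSection s) (c : hs.corr.C) :
    Vanishes ((hs.cycle.incl (hs.corrSnd c)).2 - ψ.pos (hs.corrFst c)) :=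
  (Subtype.property (p := fun q => q ∈ hs.corrAlg) c).2

/-- The pair `ψ` and the pair of the cycle `ψ ∘ s` are asymptotically equal on the
correspondence. -/
theorem Pair.IsQuasiSection.homotopic_corr {X : SepExt.{u, max u v} A} {ψ : Pair X B}
    {s : A → X.C} (hs : ψ.IsQuasiSection s) :
    Pair.Homotopic (ψ.comp hs.corrFst hs.p_corrFst)
      (hs.cycle.toPair.comp hs.corrSnd hs.p_corrSnd) := by
  refine Pair.homotopic_of_vanishes hs.vanishes_corr fun c => ?_
  have h0 := hs.vanishes_corr c
  have ha : (hs.cycle.incl (hs.corrSnd c)).1 = X.p (hs.corrFst c) :=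
    (hs.p_corrSnd c).trans (hs.p_corrFst c).symm
  change Vanishes ((hs.cycle.incl (hs.corrSnd c)).2 -
    ψ.pos (s (hs.cycle.incl (hs.corrSnd c)).1) + ψ.neg (s (hs.cycle.incl (hs.corrSnd c)).1) -
    ψ.neg (hs.corrFst c))
  rw [ha]
  -- `c - s(p(c))` lies in `J`, where `ψ⁺` and `ψ⁻` agree.
  have hJ := ψ.agree (hs.corrFst c - s (X.p (hs.corrFst c)))
    (by rw [map_sub, hs.right_inv, sub_self])
  have h1 := ψ.isAsympHom_pos.map_sub (hs.corrFst c) (s (X.p (hs.corrFst c)))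
  have h2 := ψ.isAsympHom_neg.map_sub (hs.corrFst c) (s (X.p (hs.corrFst c)))
  rw [hJ] at h1
  refine ((h0.add h2).sub h1).congr ?_
  convert vanishes_zero using 1
  abel

theorem delta_gamma (x : EN A B) : delta A B (gamma A B x) = x := by
  obtain ⟨X, ψ, rfl⟩ := EN.exists_mk x
  obtain ⟨s, hs'⟩ := X.exists_isSection
  have hs := hs'.isQuasiSection ψ
  rw [gamma_mk hs, delta_mk, ← EN.mk_comp ψ hs.corrFst hs.p_corrFst,
    ← EN.mk_comp hs.cycle.toPair hs.corrSnd hs.p_corrSnd]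
  exact (EN.mk_eq_of_homotopic hs.homotopic_corr).symm

end Inverse

end AsympKK

theorem mainTheorem2 {A : Type u} [NonUnitalCStarAlgebra A] [TopologicalSpace.SeparableSpace A]
    {B : Type v} [NonUnitalCStarAlgebra B] :
    (∀ X : AsympKK.SepExt.{u, max u v} A, ∃ s : A → X.C, X.IsSection s) ∧
    ∃ γ : AsympKK.EN A B → AsympKK.EM A B,
      AsympKK.IsGamma γ ∧ (∀ γ' : AsympKK.EN A B → AsympKK.EM A B, AsympKK.IsGamma γ' → γ' = γ) ∧
      Function.Bijective γ ∧
      ∀ (S : AsympKK.IsometryPair B) (x y : AsympKK.EN A B),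
        γ (AsympKK.EN.add S x y) = AsympKK.EM.add S (γ x) (γ y) :=
  ⟨fun X => X.exists_isSection, AsympKK.gamma A B, AsympKK.isGamma_gamma,
    fun _ h => AsympKK.isGamma_gamma.eq h,
    Function.bijective_iff_has_inverse.2
      ⟨AsympKK.delta A B, AsympKK.delta_gamma, AsympKK.gamma_delta⟩,
    AsympKK.gamma_add⟩
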